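/- **Theorem 1.4 (products that start with $\mathbf 1$).** For a real matrix $M$ with $r$ rows and $s$ columns, write $\|M\|_{\ell^\infty\to\ell^\infty} := \sup_{|x|_\infty\le 1}|Mx|_\infty = \max_{1\le i\le r}\sum_{j=1}^{s}|M_{ij}|$, and let $\mathbf 1_{m,n}$ be the $m\times n$ matrix with all entries equal to $1$. Let $\alpha>1$, let $p\ge 1$ be an integer, and let $\mu_1,\dots,\mu_p$ be probability measures on $\mathbb R$ with mean $0$, variance $1$ and finite moment of order $2\alpha$. For all integers $n_0,\dots,n_p\ge 1$, let $A^{(k)}=(A^{(k)}_{ij})_{1\le i\le n_{k-1},\,1\le j\le n_k}$, $1\le k\le p$, be random matrices such that all the entries of all these matrices are jointly independent and every entry of $A^{(k)}$ has law $\mu_k$ (the laws $\mu_1,\dots,\mu_p$ do not depend on $n_0,\dots,n_p$). Let $$P := A^{(1)}\cdots A^{(p)}\in\mathbb R^{n_0\times n_p}.$$ Then, for every choice of integers $m=m(n_0,\dots,n_p)\ge 1$, as $n_0\asymp\cdots\asymp n_p\to\infty$, $$n_p^{-1}\,(n_0\cdots n_{p-1})^{-\frac12}\,\|\mathbf 1_{m,n_0}P\|_{\ell^\infty\to\ell^\infty}\longrightarrow\sqrt{\tfrac2\pi}\quad\text{in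 probability},$$ that is: for every $C<+\infty$ and $\varepsilon,\delta>0$ there exists $N\in\mathbb N$ such that whenever $N\le n_q\le C\,n_{q'}$ for all $q,q'\in\{0,\dots,p\}$, $$\mathbb P\left[\left|\,n_p^{-1}(n_0\cdots n_{p-1})^{-\frac12}\|\mathbf 1_{m,n_0}P\|_{\ell^\infty\to\ell^\infty}-\sqrt{\tfrac2\pi}\,\right|\ge\varepsilon\right]\le\delta .$$ -/

import Mathlib

open MeasureTheory ProbabilityTheory
open scoped Matrix

noncomputable section

/-- The product `A 0 * A 1 * ⋯ * A (p - 1)` of `p` rectangular real matrices of compatible sizes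
`d 0 × d 1`, `d 1 × d 2`, …, `d (p - 1) × d p`. -/
def chainProd : (p : ℕ) → (d : Fin (p + 1) → ℕ) →
    ((k : Fin p) → Matrix (Fin (d k.castSucc)) (Fin (d k.succ)) ℝ) →
    Matrix (Fin (d 0)) (Fin (d (Fin.last p))) ℝ
  | 0, d, _ => (1 : Matrix (Fin (d 0)) (Fin (d 0)) ℝ)
  | p + 1, d, A =>
      chainProd p (fun i => d i.castSucc) (fun k => A k.castSucc) * A (Fin.last p)

/-- The `m × n` matrix with all entries equal to `1`. -/
def onesMatrix (m n : ℕ) : Matrix (Fin m) (Fin n) ℝ := Matrix.of fun _ _ => 1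

/-- The `ℓ^∞ → ℓ^∞` operator norm of a real matrix. (The norm on `Fin n → ℝ` is the sup norm, and
the outer norm is the operator norm of continuous linear maps.) -/
def linftyOperatorNorm {m n : ℕ} (A : Matrix (Fin m) (Fin n) ℝ) : ℝ :=
  ‖(LinearMap.toContinuousLinearMap (Matrix.mulVecLin A) : (Fin n → ℝ) →L[ℝ] (Fin m → ℝ))‖

/-- Convergence in probability of `U (n₀, …, n_p)` to the constant `c` as
`n₀ ≍ ⋯ ≍ n_p → ∞`. For each tuple of sizes `n`, the random variable `U n` lives on its own
probability space `(Ω n, Pr n)`. -/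
def TendstoInProbComparable {p : ℕ} {Ω : (Fin (p + 1) → ℕ) → Type*}
    [∀ n, MeasurableSpace (Ω n)] (Pr : ∀ n, Measure (Ω n)) (U : ∀ n, Ω n → ℝ) (c : ℝ) : Prop :=
  ∀ C ε δ : ℝ, 0 < ε → 0 < δ → ∃ N : ℕ, ∀ n : Fin (p + 1) → ℕ,
    (∀ q q' : Fin (p + 1), N ≤ n q ∧ (n q : ℝ) ≤ C * (n q' : ℝ)) →
      Pr n {ω | ε ≤ |U n ω - c|} ≤ ENNReal.ofReal δ

end

/-! ### A smooth approximation of the absolute value -/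

/-! All rows of the product with the ones matrix equal the vector of column sums of `P`, so the
scaled norm is the mean absolute entry of `chainVec`: the vector (1,…,1) pushed through the layers,
each normalised by the square root of its input size (`scaled_norm_eq_meanAbs_chainVec`). Given the
input `u` of the last layer, the output entries are independent, and each is a normalised sum with
weights `u i`, close to a centred Gaussian of variance `meanSq u`. Averaging over the outputs gives
about √(2/π)·√(`meanSq u`). Each layer preserves `meanSq` in conditional mean and perturbs it
little, so `meanSq u` stays near 1.

For bounded entries this is made quantitative by a central limit theorem for the first absolute
moment (`abs_integral_abs_sum_sub_le`, exchanging summands for Gaussians one at a time), a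
conditional law of large numbers (`integral_sq_mean_sub_le`), and an induction over layers
(`chainVec_bounds`).

For square integrable entries, each entry x is replaced by τ(x), with τ bounded, centred, of
variance 1, and with ρ = E[xτ(x)] close to 1 (`exists_bounded_normalised_approx`). Both chains use
the same randomness, and the covariance of corresponding outputs is exactly the product of the ρ's
(`integral_chainVec_mul`). Their squared L² distance is thus 2 − 2∏ρ, uniformly in the sizes.
Convergence in mean follows, and Markov's inequality gives convergence in probability. -/

theorem abs_taylor_two_le {f f' f'' : ℝ → ℝ} {L : ℝ} (hf : ∀ x, HasDerivAt f (f' x) x)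
    (hf' : ∀ x, HasDerivAt f' (f'' x) x) (hL : ∀ x y, |f'' x - f'' y| ≤ L * |x - y|) (z y : ℝ) :
    |f (z + y) - (f z + f' z * y + f'' z / 2 * y ^ 2)| ≤ L * |y| ^ 3 := by
  have hL0 : 0 ≤ L := by simpa using (abs_nonneg _).trans (hL 1 0)
  set s : Set ℝ := Set.Icc (-|y|) |y| with hs
  have hconv : Convex ℝ s := convex_Icc _ _
  have h0 : (0 : ℝ) ∈ s := by simp [hs]
  have hy : y ∈ s := ⟨neg_abs_le y, le_abs_self y⟩
  have hd (x : ℝ) : HasDerivAt (fun t => f' (z + t) - f' z - f'' z * t) (f'' (z + x) - f'' z) x := by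
    have h1 : HasDerivAt (fun t => f' (z + t)) (f'' (z + x)) x := (hf' (z + x)).comp_const_add z x
    have h2 : HasDerivAt (fun t => f'' z * t) (f'' z) x := by
      simpa using (hasDerivAt_id x).const_mul (f'' z)
    exact (h1.sub_const (f' z)).sub h2
  -- Two mean value estimates on [-|y|, |y|], one for the derivative and one for the function; this
  -- avoids signs of `y` and costs only the factor 1/6.
  have hb (x : ℝ) (hx : x ∈ s) : |f' (z + x) - f' z - f'' z * x| ≤ L * |y| ^ 2 := by
    have := hconv.norm_image_sub_le_of_norm_hasDerivWithin_le
      (f := fun t => f' (z + t) - f' z - f'' z * t) (C := L * |y|)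
      (fun t _ => (hd t).hasDerivWithinAt) (fun t ht => by
        have := hL (z + t) z
        rw [add_sub_cancel_left] at this
        exact this.trans (mul_le_mul_of_nonneg_left (abs_le.2 ht) hL0)) h0 hx
    simp only [add_zero, sub_self, mul_zero, sub_zero, Real.norm_eq_abs] at this
    refine this.trans ?_
    rw [pow_two, ← mul_assoc]
    exact mul_le_mul_of_nonneg_left (abs_le.2 hx) (by positivity)
  have hd2 (x : ℝ) : HasDerivAt (fun t => f (z + t) - (f z + f' z * t + f'' z / 2 * t ^ 2))
      (f' (z + x) - f' z - f'' z * x) x := by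
    have h1 : HasDerivAt (fun t => f (z + t)) (f' (z + x)) x := (hf (z + x)).comp_const_add z x
    have h2 : HasDerivAt (fun t => f z + f' z * t + f'' z / 2 * t ^ 2)
        (f' z + f'' z / 2 * (2 * x)) x := by
      have := (((hasDerivAt_id x).const_mul (f' z)).const_add (f z)).add
        (((hasDerivAt_id x).pow 2).const_mul (f'' z / 2))
      convert! this using 1
      simp
    convert! h1.sub h2 using 1
    ring
  have := hconv.norm_image_sub_le_of_norm_hasDerivWithin_le
    (f := fun t => f (z + t) - (f z + f' z * t + f'' z / 2 * t ^ 2)) (C := L * |y| ^ 2)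
    (fun t _ => (hd2 t).hasDerivWithinAt) hb h0 hy
  simp only [add_zero, mul_zero, ne_eq, OfNat.ofNat_ne_zero, not_false_eq_true, zero_pow,
    sub_self, sub_zero, Real.norm_eq_abs] at this
  calc _ ≤ _ := this
    _ = _ := by ring

/-- The function `x ↦ √(1 + x²)`, a smooth approximation of the absolute value. -/
noncomputable def smoothAbs (x : ℝ) : ℝ := √(1 + x ^ 2)

theorem smoothAbs_sq (x : ℝ) : smoothAbs x ^ 2 = 1 + x ^ 2 := Real.sq_sqrt (by positivity)

theorem one_le_smoothAbs (x : ℝ) : 1 ≤ smoothAbs x := by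
  rw [smoothAbs, Real.one_le_sqrt]; nlinarith [sq_nonneg x]

theorem abs_le_smoothAbs (x : ℝ) : |x| ≤ smoothAbs x :=
  Real.abs_le_sqrt (by linarith)

theorem smoothAbs_le (x : ℝ) : smoothAbs x ≤ 1 + |x| := by
  rw [smoothAbs, Real.sqrt_le_left (by positivity)]
  nlinarith [abs_nonneg x, sq_abs x]

theorem continuous_smoothAbs : Continuous smoothAbs := by
  unfold smoothAbs; fun_prop

theorem hasDerivAt_smoothAbs (x : ℝ) : HasDerivAt smoothAbs (x / smoothAbs x) x := by
  have h : HasDerivAt (fun t : ℝ => 1 + t ^ 2) (2 * x) x := by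
    simpa using ((hasDerivAt_id x).pow 2).const_add 1
  convert! h.sqrt (by positivity) using 1
  rw [smoothAbs]
  field_simp

theorem hasDerivAt_deriv_smoothAbs (x : ℝ) :
    HasDerivAt (fun t => t / smoothAbs t) ((smoothAbs x ^ 3)⁻¹) x := by
  have h1 := one_le_smoothAbs x
  have h0 : smoothAbs x ≠ 0 := by positivity
  convert! (hasDerivAt_id x).div (hasDerivAt_smoothAbs x) h0 using 1
  have := smoothAbs_sq x
  simp only [id]
  field_simp
  linarith

/-- The derivative is -3t / `smoothAbs t` ^ 5, and |t| ≤ `smoothAbs t` ≤ `smoothAbs t` ^ 5. -/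
theorem abs_inv_smoothAbs_cube_sub_le (x y : ℝ) :
    |(smoothAbs x ^ 3)⁻¹ - (smoothAbs y ^ 3)⁻¹| ≤ 3 * |x - y| := by
  have hd (t : ℝ) : HasDerivAt (fun t => (smoothAbs t ^ 3)⁻¹)
      (-(3 * smoothAbs t ^ 2 * (t / smoothAbs t)) / (smoothAbs t ^ 3) ^ 2) t := by
    have h1 : 0 < smoothAbs t := one_pos.trans_le (one_le_smoothAbs t)
    simpa using ((hasDerivAt_smoothAbs t).fun_pow 3).fun_inv (pow_pos h1 3).ne'
  have := convex_univ.norm_image_sub_le_of_norm_hasDerivWithin_le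
    (f := fun t => (smoothAbs t ^ 3)⁻¹) (C := 3)
    (fun t _ => (hd t).hasDerivWithinAt) (fun t _ => by
      have h1 := one_le_smoothAbs t
      have h2 := abs_le_smoothAbs t
      have h4 : smoothAbs t ≤ smoothAbs t ^ 5 := le_self_pow₀ h1 (by norm_num)
      have : -(3 * smoothAbs t ^ 2 * (t / smoothAbs t)) / (smoothAbs t ^ 3) ^ 2
          = -3 * (t / smoothAbs t ^ 5) := by
        field_simp
      rw [this, norm_mul, Real.norm_eq_abs, Real.norm_eq_abs, abs_div,
        abs_of_pos (by positivity : 0 < smoothAbs t ^ 5)]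
      have : |t| / smoothAbs t ^ 5 ≤ 1 := (div_le_one (by positivity)).2 (h2.trans h4)
      norm_num
      linarith) (Set.mem_univ y) (Set.mem_univ x)
  simpa using this

theorem smoothAbs_taylor (z y : ℝ) :
    |smoothAbs (z + y) - (smoothAbs z + z / smoothAbs z * y + (smoothAbs z ^ 3)⁻¹ / 2 * y ^ 2)|
      ≤ 3 * |y| ^ 3 :=
  abs_taylor_two_le hasDerivAt_smoothAbs hasDerivAt_deriv_smoothAbs
    abs_inv_smoothAbs_cube_sub_le z y

/-! ### Comparison of convolutions -/

theorem integrable_of_abs_le_one_add {Ω : Type*} [MeasurableSpace Ω] {P : Measure Ω}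
    [IsFiniteMeasure P] {X : Ω → ℝ} (hX : Integrable X P) {f : ℝ → ℝ} (hf : Continuous f)
    {c : ℝ} (hfb : ∀ x, |f x| ≤ c + |x|) : Integrable (fun ω => f (X ω)) P :=
  ((integrable_const c).add hX.abs).mono' (hf.comp_aestronglyMeasurable hX.1)
    (ae_of_all _ fun ω => hfb (X ω))

theorem integrable_id_conv {ν γ : Measure ℝ} [IsProbabilityMeasure ν] [IsProbabilityMeasure γ]
    (hν : Integrable id ν) (hγ : Integrable id γ) : Integrable id (ν ∗ γ) := by
  rw [Measure.conv, integrable_map_measure (by fun_prop) (by fun_prop)]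
  exact (hν.comp_fst γ).add (hγ.comp_snd ν)

/-- Total error of convolutions: the errors in the comparison of the factors add up. -/
theorem abs_integral_conv_sub_le {f : ℝ → ℝ} (hf : Continuous f) (hfb : ∀ x, |f x| ≤ 1 + |x|)
    {ν₁ ν₂ γ₁ γ₂ : Measure ℝ} [IsProbabilityMeasure ν₁] [IsProbabilityMeasure ν₂]
    [IsProbabilityMeasure γ₁] [IsProbabilityMeasure γ₂]
    (hν₁ : Integrable id ν₁) (hν₂ : Integrable id ν₂) (hγ₁ : Integrable id γ₁)
    (hγ₂ : Integrable id γ₂) {D₁ D₂ : ℝ}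
    (h₁ : ∀ z, |∫ x, f (z + x) ∂ν₁ - ∫ x, f (z + x) ∂γ₁| ≤ D₁)
    (h₂ : ∀ z, |∫ x, f (z + x) ∂ν₂ - ∫ x, f (z + x) ∂γ₂| ≤ D₂) (z : ℝ) :
    |∫ x, f (z + x) ∂(ν₁ ∗ ν₂) - ∫ x, f (z + x) ∂(γ₁ ∗ γ₂)| ≤ D₁ + D₂ := by
  have hint {ν : Measure ℝ} [IsProbabilityMeasure ν] (hν : Integrable id ν) :
      Integrable (fun x => f (z + x)) ν :=
    integrable_of_abs_le_one_add (f := fun x => f (z + x)) (c := 1 + |z|) hν (by fun_prop)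
      fun x => (hfb _).trans (by linarith [abs_add_le z x])
  have hintp {ν γ : Measure ℝ} [IsProbabilityMeasure ν] [IsProbabilityMeasure γ]
      (hν : Integrable id ν) (hγ : Integrable id γ) :
      Integrable (fun p : ℝ × ℝ => f (z + (p.1 + p.2))) (ν.prod γ) := by
    have := hint (integrable_id_conv hν hγ)
    rwa [Measure.conv, integrable_map_measure (by fun_prop) (by fun_prop)] at this
  have hconv {ν γ : Measure ℝ} [IsProbabilityMeasure ν] [IsProbabilityMeasure γ]
      (hν : Integrable id ν) (hγ : Integrable id γ) :
      ∫ x, f (z + x) ∂(ν ∗ γ) = ∫ x, ∫ y, f (z + (x + y)) ∂γ ∂ν :=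
    integral_conv (hint (integrable_id_conv hν hγ))
  -- One factor is exchanged at a time, through `ν₁ ∗ γ₂`. The factor kept fixed only shifts `z`,
  -- which is why the hypotheses are uniform in `z`.
  have hA : |∫ x, f (z + x) ∂(ν₁ ∗ ν₂) - ∫ x, f (z + x) ∂(ν₁ ∗ γ₂)| ≤ D₂ := by
    rw [hconv hν₁ hν₂, hconv hν₁ hγ₂, ← integral_sub (hintp hν₁ hν₂).integral_prod_left
      (hintp hν₁ hγ₂).integral_prod_left, ← Real.norm_eq_abs]
    refine (norm_integral_le_of_norm_le_const (C := D₂) (ae_of_all _ fun x => ?_)).trans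
      (by simp)
    simpa only [add_assoc, Real.norm_eq_abs] using h₂ (z + x)
  have hB : |∫ x, f (z + x) ∂(ν₁ ∗ γ₂) - ∫ x, f (z + x) ∂(γ₁ ∗ γ₂)| ≤ D₁ := by
    rw [Measure.conv_comm ν₁, Measure.conv_comm γ₁, hconv hγ₂ hν₁, hconv hγ₂ hγ₁,
      ← integral_sub (hintp hγ₂ hν₁).integral_prod_left (hintp hγ₂ hγ₁).integral_prod_left,
      ← Real.norm_eq_abs]
    refine (norm_integral_le_of_norm_le_const (C := D₁) (ae_of_all _ fun x => ?_)).trans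
      (by simp)
    simpa only [add_assoc, Real.norm_eq_abs] using h₁ (z + x)
  calc _ ≤ _ := abs_sub_le _ (∫ x, f (z + x) ∂(ν₁ ∗ γ₂)) _
    _ ≤ _ := by linarith

/-- Centring kills the linear Taylor term. The main part then sees the law only through its second
moment, so it is common to all centred laws of the same variance. -/
theorem abs_integral_smoothAbs_sub_le {ν : Measure ℝ} [IsProbabilityMeasure ν]
    (hν : MemLp id 3 ν) (hmean : ∫ x, x ∂ν = 0) (z : ℝ) :
    |∫ x, smoothAbs (z + x) ∂ν - (smoothAbs z + (smoothAbs z ^ 3)⁻¹ / 2 * ∫ x, x ^ 2 ∂ν)|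
      ≤ 3 * ∫ x, |x| ^ 3 ∂ν := by
  have h1 : Integrable (fun x : ℝ => x) ν := hν.integrable (by norm_num)
  have h2 : Integrable (fun x : ℝ => x ^ 2) ν :=
    (hν.mono_exponent (by norm_num : (2 : ENNReal) ≤ 3)).integrable_sq
  have h3 : Integrable (fun x : ℝ => |x| ^ 3) ν := by
    simpa using hν.integrable_norm_pow (p := 3) (by norm_num)
  have hf : Integrable (fun x => smoothAbs (z + x)) ν :=
    integrable_of_abs_le_one_add (f := fun x => smoothAbs (z + x)) (c := 1 + |z|) h1
      (continuous_smoothAbs.comp (by fun_prop)) fun x => by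
        rw [abs_of_nonneg (by linarith [one_le_smoothAbs (z + x)])]
        linarith [smoothAbs_le (z + x), abs_add_le z x]
  have ha : Integrable (fun x : ℝ => smoothAbs z + z / smoothAbs z * x) ν :=
    (integrable_const _).add (h1.const_mul _)
  have hab : Integrable (fun x : ℝ => smoothAbs z + z / smoothAbs z * x
      + (smoothAbs z ^ 3)⁻¹ / 2 * x ^ 2) ν := ha.add (h2.const_mul _)
  have hq : ∫ x, (smoothAbs z + z / smoothAbs z * x + (smoothAbs z ^ 3)⁻¹ / 2 * x ^ 2) ∂ν
      = smoothAbs z + (smoothAbs z ^ 3)⁻¹ / 2 * ∫ x, x ^ 2 ∂ν := by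
    rw [integral_add ha (h2.const_mul _),
      integral_add (integrable_const _) (h1.const_mul _), integral_const_mul, integral_const_mul,
      hmean]
    simp
  rw [← hq, ← integral_sub hf hab, ← integral_const_mul]
  exact (abs_integral_le_integral_abs).trans (integral_mono_of_nonneg
    (ae_of_all _ fun x => abs_nonneg _) (h3.const_mul 3) (ae_of_all _ fun x => smoothAbs_taylor z x))

/-! ### Gaussian moments -/

theorem integral_abs_gaussianReal_zero_one :
    ∫ x, |x| ∂(gaussianReal 0 1) = √(2 / Real.pi) := by
  rw [integral_gaussianReal_eq_integral_smul one_ne_zero]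
  have h : ∀ x : ℝ, gaussianPDFReal 0 1 x • |x|
      = (√(2 * Real.pi))⁻¹ * (|x| * Real.exp (-(1 / 2) * |x| ^ 2)) := by
    intro x
    rw [gaussianPDFReal_def, smul_eq_mul, sq_abs]
    simp only [NNReal.coe_one, mul_one, sub_zero]
    rw [show -x ^ 2 / 2 = -(1 / 2) * x ^ 2 by ring]
    ring
  simp_rw [h]
  rw [integral_const_mul, integral_comp_abs (f := fun x => x * Real.exp (-(1 / 2) * x ^ 2))]
  have h2 := integral_rpow_mul_exp_neg_mul_rpow (p := 2) (q := 1) (b := 1 / 2) two_pos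
    (by norm_num) (by norm_num)
  simp only [Real.rpow_one, Real.rpow_two] at h2
  rw [h2]
  norm_num
  have hpi := Real.pi_pos
  have h3 : √2 * √2 = 2 := Real.mul_self_sqrt (by norm_num)
  field_simp
  linarith

theorem integral_abs_pow_gaussianReal (u : ℝ) (k : ℕ) :
    ∫ x, |x| ^ k ∂(gaussianReal 0 (u ^ 2).toNNReal)
      = |u| ^ k * ∫ x, |x| ^ k ∂(gaussianReal 0 1) := by
  have := gaussianReal_map_const_mul (μ := 0) (v := 1) u
  rw [mul_zero, mul_one] at this
  rw [Real.toNNReal_of_nonneg (sq_nonneg u), ← this, integral_map (by fun_prop) (by fun_prop), ← integral_const_mul]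
  simp_rw [abs_mul, mul_pow]

theorem integral_sq_gaussianReal (u : ℝ) :
    ∫ x, x ^ 2 ∂(gaussianReal 0 (u ^ 2).toNNReal) = u ^ 2 := by
  have := variance_fun_id_gaussianReal (μ := 0) (v := (u ^ 2).toNNReal)
  rw [variance_eq_integral measurable_id'.aemeasurable] at this
  simpa [sq_nonneg] using this

/-- Smoothing costs at most 1; a later rescaling turns this into an arbitrarily small error. -/
theorem integral_abs_le_integral_smoothAbs {Ω : Type*} [MeasurableSpace Ω] {Q : Measure Ω}
    [IsProbabilityMeasure Q] {Y : Ω → ℝ} (hY : Integrable Y Q) :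
    ∫ ω, |Y ω| ∂Q ≤ ∫ ω, smoothAbs (Y ω) ∂Q ∧
      ∫ ω, smoothAbs (Y ω) ∂Q ≤ ∫ ω, |Y ω| ∂Q + 1 := by
  have hi : Integrable (fun ω => smoothAbs (Y ω)) Q :=
    integrable_of_abs_le_one_add hY continuous_smoothAbs (c := 1) fun x => by
      rw [abs_of_nonneg (zero_le_one.trans (one_le_smoothAbs x))]
      exact smoothAbs_le x
  refine ⟨integral_mono hY.abs hi fun ω => abs_le_smoothAbs _, ?_⟩
  have := integral_mono hi ((integrable_const (1 : ℝ)).add hY.abs) fun ω => smoothAbs_le _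
  simp only [Pi.add_apply] at this
  rw [integral_add (integrable_const _) hY.abs] at this
  simp at this
  linarith

/-! ### Bounded random variables -/

/-- Bounded measurable real functions. -/
def IsBddMeasurable {Ω : Type*} [MeasurableSpace Ω] (X : Ω → ℝ) : Prop :=
  Measurable X ∧ ∃ C, ∀ ω, |X ω| ≤ C

namespace IsBddMeasurable

variable {Ω : Type*} [MeasurableSpace Ω] {X Y : Ω → ℝ} {P : Measure Ω}

theorem const (c : ℝ) : IsBddMeasurable (fun _ : Ω => c) := ⟨measurable_const, |c|, fun _ => le_rfl⟩

theorem add (hX : IsBddMeasurable X) (hY : IsBddMeasurable Y) :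
    IsBddMeasurable (fun ω => X ω + Y ω) := by
  obtain ⟨mX, C, hC⟩ := hX
  obtain ⟨mY, D, hD⟩ := hY
  exact ⟨mX.add mY, C + D, fun ω => (abs_add_le _ _).trans (add_le_add (hC ω) (hD ω))⟩

theorem mul (hX : IsBddMeasurable X) (hY : IsBddMeasurable Y) :
    IsBddMeasurable (fun ω => X ω * Y ω) := by
  obtain ⟨mX, C, hC⟩ := hX
  obtain ⟨mY, D, hD⟩ := hY
  refine ⟨mX.mul mY, C * D, fun ω => ?_⟩
  rw [abs_mul]
  exact mul_le_mul (hC ω) (hD ω) (abs_nonneg _) ((abs_nonneg _).trans (hC ω))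

theorem const_mul (hX : IsBddMeasurable X) (c : ℝ) : IsBddMeasurable (fun ω => c * X ω) :=
  (const c).mul hX

theorem sub (hX : IsBddMeasurable X) (hY : IsBddMeasurable Y) :
    IsBddMeasurable (fun ω => X ω - Y ω) := by
  simpa [sub_eq_add_neg] using hX.add (hY.const_mul (-1))

theorem pow (hX : IsBddMeasurable X) (k : ℕ) : IsBddMeasurable (fun ω => X ω ^ k) := by
  induction k with
  | zero => simpa using const 1
  | succ k ih => simpa [pow_succ] using ih.mul hX

theorem abs (hX : IsBddMeasurable X) : IsBddMeasurable (fun ω => |X ω|) := by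
  obtain ⟨mX, C, hC⟩ := hX
  exact ⟨by fun_prop, C, by simpa using hC⟩

theorem sqrt (hX : IsBddMeasurable X) : IsBddMeasurable (fun ω => √(X ω)) := by
  obtain ⟨mX, C, hC⟩ := hX
  refine ⟨by fun_prop, √C, fun ω => ?_⟩
  rw [abs_of_nonneg (Real.sqrt_nonneg _)]
  exact Real.sqrt_le_sqrt ((le_abs_self _).trans (hC ω))

theorem sum {ι : Type*} {s : Finset ι} {X : ι → Ω → ℝ} (hX : ∀ i ∈ s, IsBddMeasurable (X i)) :
    IsBddMeasurable (fun ω => ∑ i ∈ s, X i ω) := by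
  classical
  induction s using Finset.induction_on with
  | empty => simpa using const 0
  | insert i s hi ih =>
    simp only [Finset.sum_insert hi]
    exact (hX i (s.mem_insert_self i)).add (ih fun j hj => hX j (Finset.mem_insert_of_mem hj))

theorem integrable [IsFiniteMeasure P] (hX : IsBddMeasurable X) : Integrable X P := by
  obtain ⟨mX, C, hC⟩ := hX
  exact Integrable.of_bound mX.aestronglyMeasurable C (ae_of_all _ hC)

theorem memLp [IsFiniteMeasure P] (hX : IsBddMeasurable X) (p : ENNReal) : MemLp X p P := by
  obtain ⟨mX, C, hC⟩ := hX
  exact MemLp.of_bound mX.aestronglyMeasurable C (ae_of_all _ hC)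

theorem comp {Ω' : Type*} [MeasurableSpace Ω'] (hX : IsBddMeasurable X) {φ : Ω' → Ω}
    (hφ : Measurable φ) : IsBddMeasurable (fun ω => X (φ ω)) :=
  ⟨hX.1.comp hφ, hX.2.imp fun _ hC ω => hC (φ ω)⟩

end IsBddMeasurable

/-! ### Independence -/

/-- Conditioning on `U` in integrated form: by Fubini for the product law, `Y` may be averaged with
`U` frozen. -/
theorem integral_indepFun_eq_integral_integral {Ω α β : Type*} [MeasurableSpace Ω]
    [MeasurableSpace α] [MeasurableSpace β] {P : Measure Ω} [IsProbabilityMeasure P]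
    {U : Ω → α} {Y : Ω → β} (h : IndepFun U Y P) (hU : Measurable U) (hY : Measurable Y)
    {F : α × β → ℝ} (hF : Measurable F) (hint : Integrable (fun ω => F (U ω, Y ω)) P) :
    ∫ ω, F (U ω, Y ω) ∂P = ∫ ω, ∫ ω', F (U ω, Y ω') ∂P ∂P := by
  have hmap := (indepFun_iff_map_prod_eq_prod_map_map hU.aemeasurable hY.aemeasurable).1 h
  have := Measure.isProbabilityMeasure_map (μ := P) hU.aemeasurable
  have := Measure.isProbabilityMeasure_map (μ := P) hY.aemeasurable
  have hi : Integrable F ((P.map U).prod (P.map Y)) := by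
    rw [← hmap, integrable_map_measure hF.aestronglyMeasurable (hU.prodMk hY).aemeasurable]
    exact hint
  rw [← integral_map (φ := fun ω => (U ω, Y ω)) (hU.prodMk hY).aemeasurable
    hF.aestronglyMeasurable, hmap, integral_prod _ hi, integral_map hU.aemeasurable
    hF.stronglyMeasurable.integral_prod_right'.aestronglyMeasurable]
  refine integral_congr_ae (ae_of_all _ fun ω => ?_)
  exact integral_map hY.aemeasurable (hF.comp measurable_prodMk_left).aestronglyMeasurable

theorem iIndepFun_indepFun_of_disjoint_range {Ω ι κ₁ κ₂ : Type*} [MeasurableSpace Ω]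
    {P : Measure Ω} [Finite κ₁] [Finite κ₂] {f : ι → Ω → ℝ} (h : iIndepFun f P)
    (hf : ∀ i, Measurable (f i)) (e₁ : κ₁ → ι) (e₂ : κ₂ → ι) (he : ∀ k l, e₁ k ≠ e₂ l) :
    IndepFun (fun ω k => f (e₁ k) ω) (fun ω l => f (e₂ l) ω) P := by
  classical
  cases nonempty_fintype κ₁
  cases nonempty_fintype κ₂
  have hd : Disjoint (Finset.univ.image e₁) (Finset.univ.image e₂) := by
    rw [Finset.disjoint_left]
    rintro x hx hy
    obtain ⟨k, -, rfl⟩ := Finset.mem_image.1 hx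
    obtain ⟨l, -, hl⟩ := Finset.mem_image.1 hy
    exact he k l hl.symm
  have := h.indepFun_finset _ _ hd hf
  exact this.comp
    (φ := fun (x : (Finset.univ.image e₁) → ℝ) k =>
      x ⟨e₁ k, Finset.mem_image_of_mem _ (Finset.mem_univ k)⟩)
    (ψ := fun (x : (Finset.univ.image e₂) → ℝ) k =>
      x ⟨e₂ k, Finset.mem_image_of_mem _ (Finset.mem_univ k)⟩)
    (by fun_prop) (by fun_prop)

/-! ### Sums of independent bounded centred random variables -/

section Column

variable {Ω ι : Type*} [MeasurableSpace Ω] {P : Measure Ω} [IsProbabilityMeasure P]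
  {X : ι → Ω → ℝ}

/-- When one summand is added, every cross term containing a first power vanishes. The only
surviving cross term of the fourth power has coefficient 6 ≤ 2K, hence fits into K(s + u²)². -/
theorem moments_sum_of_iIndepFun (hindep : iIndepFun X P) (hX : ∀ i, IsBddMeasurable (X i))
    (hmean : ∀ i, ∫ ω, X i ω ∂P = 0) {u : ι → ℝ} {K : ℝ} (hK : 3 ≤ K)
    (h2 : ∀ i, ∫ ω, X i ω ^ 2 ∂P = u i ^ 2) (h4 : ∀ i, ∫ ω, X i ω ^ 4 ∂P ≤ K * u i ^ 4)
    (s : Finset ι) :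
    ∫ ω, ∑ i ∈ s, X i ω ∂P = 0 ∧ ∫ ω, (∑ i ∈ s, X i ω) ^ 2 ∂P = ∑ i ∈ s, u i ^ 2 ∧
      ∫ ω, (∑ i ∈ s, X i ω) ^ 4 ∂P ≤ K * (∑ i ∈ s, u i ^ 2) ^ 2 := by
  classical
  induction s using Finset.induction_on with
  | empty => simp
  | insert i s hi ih =>
    obtain ⟨ih1, ih2, ih4⟩ := ih
    set S : Ω → ℝ := fun ω => ∑ j ∈ s, X j ω with hS
    have hSb : IsBddMeasurable S := IsBddMeasurable.sum fun j _ => hX j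
    have hind : IndepFun S (X i) P := by
      have := hindep.indepFun_finsetSum_of_notMem (fun j => (hX j).1) hi
      convert! this using 1
      ext ω
      simp [hS]
    have hprod (a b : ℕ) : ∫ ω, S ω ^ a * X i ω ^ b ∂P
        = (∫ ω, S ω ^ a ∂P) * ∫ ω, X i ω ^ b ∂P :=
      (hind.comp (φ := fun x => x ^ a) (ψ := fun x => x ^ b) (by fun_prop)
        (by fun_prop)).integral_fun_mul_eq_mul_integral
        (hSb.pow a).integrable.1 ((hX i).pow b).integrable.1
    have hI (a b : ℕ) : Integrable (fun ω => S ω ^ a * X i ω ^ b) P :=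
      ((hSb.pow a).mul ((hX i).pow b)).integrable
    simp only [Finset.sum_insert hi]
    have ih1' : ∫ ω, S ω ∂P = 0 := ih1
    have ih2' : ∫ ω, S ω ^ 2 ∂P = ∑ j ∈ s, u j ^ 2 := ih2
    have ih4' : ∫ ω, S ω ^ 4 ∂P ≤ K * (∑ j ∈ s, u j ^ 2) ^ 2 := ih4
    have e2 : ∀ ω, (X i ω + S ω) ^ 2 = S ω ^ 2 * X i ω ^ 0 + 2 * (S ω ^ 1 * X i ω ^ 1)
        + S ω ^ 0 * X i ω ^ 2 := fun ω => by ring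
    have e4 : ∀ ω, (X i ω + S ω) ^ 4 = S ω ^ 4 * X i ω ^ 0 + 4 * (S ω ^ 3 * X i ω ^ 1)
        + 6 * (S ω ^ 2 * X i ω ^ 2) + 4 * (S ω ^ 1 * X i ω ^ 3) + S ω ^ 0 * X i ω ^ 4 :=
      fun ω => by ring
    refine ⟨?_, ?_, ?_⟩
    · change ∫ ω, X i ω + S ω ∂P = 0
      rw [integral_add (hX i).integrable hSb.integrable, hmean, ih1, add_zero]
    · change ∫ ω, (X i ω + S ω) ^ 2 ∂P = _
      simp_rw [e2]
      rw [integral_add (by fun_prop (disch := exact hI _ _)) (hI _ _),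
        integral_add (hI _ _) ((hI _ _).const_mul _), integral_const_mul]
      simp only [hprod]
      simp only [pow_one, hmean, h2, ih2']
      simp
      ring
    · change ∫ ω, (X i ω + S ω) ^ 4 ∂P ≤ _
      simp_rw [e4]
      have j1 : Integrable (fun ω => S ω ^ 4 * X i ω ^ 0 + 4 * (S ω ^ 3 * X i ω ^ 1)) P :=
        (hI 4 0).add ((hI 3 1).const_mul 4)
      have j2 : Integrable (fun ω => S ω ^ 4 * X i ω ^ 0 + 4 * (S ω ^ 3 * X i ω ^ 1)
          + 6 * (S ω ^ 2 * X i ω ^ 2)) P := j1.add ((hI 2 2).const_mul 6)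
      have j3 : Integrable (fun ω => S ω ^ 4 * X i ω ^ 0 + 4 * (S ω ^ 3 * X i ω ^ 1)
          + 6 * (S ω ^ 2 * X i ω ^ 2) + 4 * (S ω ^ 1 * X i ω ^ 3)) P :=
        j2.add ((hI 1 3).const_mul 4)
      rw [integral_add j3 (hI 0 4), integral_add j2 ((hI 1 3).const_mul 4),
        integral_add j1 ((hI 2 2).const_mul 6), integral_add (hI 4 0) ((hI 3 1).const_mul 4)]
      simp only [integral_const_mul, hprod]
      simp only [pow_one, hmean, h2, ih1', ih2']
      have hu : 0 ≤ u i ^ 2 := sq_nonneg _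
      have hs : 0 ≤ ∑ j ∈ s, u j ^ 2 := Finset.sum_nonneg fun j _ => sq_nonneg _
      have := h4 i
      simp only [pow_zero, integral_const, probReal_univ, smul_eq_mul, mul_one, mul_zero,
        add_zero, zero_mul, one_mul]
      nlinarith [mul_nonneg hu hs, mul_nonneg (sub_nonneg.2 hK) (mul_nonneg hu hs)]

/-- Lindeberg exchange: each summand is traded for a Gaussian of the same variance at the price of
third absolute moments. The induction keeps `z` free, as the convolution comparison requires. -/
theorem abs_integral_smoothAbs_sum_sub_le (hindep : iIndepFun X P)
    (hX : ∀ i, IsBddMeasurable (X i)) (hmean : ∀ i, ∫ ω, X i ω ∂P = 0) {u : ι → ℝ} {R : ℝ}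
    (h2 : ∀ i, ∫ ω, X i ω ^ 2 ∂P = u i ^ 2) (h3 : ∀ i, ∫ ω, |X i ω| ^ 3 ∂P ≤ R * |u i| ^ 3)
    (s : Finset ι) (z : ℝ) :
    |∫ x, smoothAbs (z + x) ∂(P.map (fun ω => ∑ i ∈ s, X i ω))
      - ∫ x, smoothAbs (z + x) ∂(gaussianReal 0 (∑ i ∈ s, (u i ^ 2).toNNReal))|
      ≤ ∑ i ∈ s, 3 * (R + ∫ x, |x| ^ 3 ∂(gaussianReal 0 1)) * |u i| ^ 3 := by
  classical
  have hid (Y : Ω → ℝ) (hY : IsBddMeasurable Y) (p : ENNReal) : MemLp id p (P.map Y) := by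
    rw [memLp_map_measure_iff (by fun_prop) hY.1.aemeasurable]
    exact hY.memLp p
  induction s using Finset.induction_on generalizing z with
  | empty => simp
  | insert i s hi ih =>
    set S : Ω → ℝ := fun ω => ∑ j ∈ s, X j ω with hS
    have hSb : IsBddMeasurable S := IsBddMeasurable.sum fun j _ => hX j
    have hind : IndepFun S (X i) P := by
      have := hindep.indepFun_finsetSum_of_notMem (fun j => (hX j).1) hi
      convert! this using 1
      ext ω
      simp [hS]
    have := Measure.isProbabilityMeasure_map (μ := P) (hX i).1.aemeasurable
    have := Measure.isProbabilityMeasure_map (μ := P) hSb.1.aemeasurable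
    have hmap : P.map (fun ω => ∑ j ∈ insert i s, X j ω) = (P.map (X i)) ∗ (P.map S) := by
      rw [← hind.symm.map_add_eq_map_conv_map₀ (hX i).1.aemeasurable hSb.1.aemeasurable]
      congr 1
      ext ω
      simp [hS, Finset.sum_insert hi]
    -- The mean 0 is written as 0 + 0 so that the Gaussian splits as a convolution.
    rw [hmap, Finset.sum_insert hi, Finset.sum_insert hi, ← add_zero (0 : ℝ),
      ← gaussianReal_conv_gaussianReal, add_zero]
    refine abs_integral_conv_sub_le continuous_smoothAbs (fun x => ?_)
      ((hid _ (hX i) 1).integrable le_rfl) ((hid _ hSb 1).integrable le_rfl)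
      ((memLp_id_gaussianReal 1).integrable le_rfl) ((memLp_id_gaussianReal 1).integrable le_rfl)
      (fun z => ?_) ih z
    · rw [abs_of_nonneg (zero_le_one.trans (one_le_smoothAbs x))]
      exact smoothAbs_le x
    · have hA := abs_integral_smoothAbs_sub_le (hid _ (hX i) 3) (by
        rw [integral_map (hX i).1.aemeasurable (by fun_prop), hmean]) z
      have hB := abs_integral_smoothAbs_sub_le
        (memLp_id_gaussianReal (μ := 0) (v := (u i ^ 2).toNNReal) 3) (by simp) z
      rw [integral_map (hX i).1.aemeasurable (f := fun x => x ^ 2) (by fun_prop), h2,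
        integral_map (hX i).1.aemeasurable (f := fun x => |x| ^ 3) (by fun_prop)] at hA
      rw [integral_abs_pow_gaussianReal] at hB
      rw [integral_sq_gaussianReal] at hB
      have := h3 i
      rw [abs_sub_comm] at hB
      refine (abs_sub_le _ _ _).trans ((add_le_add hA hB).trans ?_)
      linarith

/-- A quantitative central limit theorem for the first absolute moment. -/
theorem abs_integral_abs_sum_sub_le [Fintype ι] {a : ι → Ω → ℝ} (hindep : iIndepFun a P)
    (ha : ∀ i, Measurable (a i)) {M : ℝ} (hM : ∀ i ω, |a i ω| ≤ M)
    (hmean : ∀ i, ∫ ω, a i ω ∂P = 0) (hvar : ∀ i, ∫ ω, a i ω ^ 2 ∂P = 1) (u : ι → ℝ) {ε : ℝ}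
    (hε : 0 < ε) :
    |∫ ω, |∑ i, u i * a i ω| ∂P - √(2 / Real.pi) * √(∑ i, u i ^ 2)|
      ≤ 2 * ε + 3 * (M ^ 3 + ∫ x, |x| ^ 3 ∂(gaussianReal 0 1)) / ε ^ 2 * ∑ i, |u i| ^ 3 := by
  -- Dividing the weights by ε and multiplying back turns the smoothing error 1 into ε and the
  -- third-moment error into ε · ε⁻³ = ε⁻² times the sum of |u|³.
  set w : ι → ℝ := fun i => u i / ε with hw
  set c := √(2 / Real.pi) with hc
  have hab (i) : IsBddMeasurable (a i) := ⟨ha i, M, hM i⟩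
  have hX (i) : IsBddMeasurable (fun ω => w i * a i ω) := (hab i).const_mul _
  have hind : iIndepFun (fun i ω => w i * a i ω) P :=
    hindep.comp (fun i x => w i * x) fun i => by fun_prop
  have main := abs_integral_smoothAbs_sum_sub_le hind hX
    (fun i => by rw [integral_const_mul, hmean, mul_zero]) (u := w) (R := M ^ 3)
    (fun i => by simp_rw [mul_pow]; rw [integral_const_mul, hvar, mul_one])
    (fun i => by
      simp_rw [abs_mul, mul_pow]
      rw [integral_const_mul, mul_comm]
      gcongr
      have := integral_mono (((hab i).abs.pow 3).integrable (P := P)) (integrable_const (M ^ 3))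
        (fun ω => pow_le_pow_left₀ (abs_nonneg _) (hM i ω) 3)
      simpa using this) Finset.univ 0
  set S : Ω → ℝ := fun ω => ∑ i, w i * a i ω with hS
  have hSb : IsBddMeasurable S := IsBddMeasurable.sum fun j _ => hX j
  simp only [zero_add] at main
  rw [integral_map hSb.1.aemeasurable continuous_smoothAbs.aestronglyMeasurable] at main
  have h1 := integral_abs_le_integral_smoothAbs (hSb.integrable (P := P))
  have h2 := integral_abs_le_integral_smoothAbs (Q := gaussianReal 0 (∑ i, (w i ^ 2).toNNReal))
    (Y := fun x => x) ((memLp_id_gaussianReal 1).integrable le_rfl)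
  have hσ : 0 ≤ ∑ i, w i ^ 2 := Finset.sum_nonneg fun i _ => sq_nonneg _
  have hG : ∫ x, |x| ∂(gaussianReal 0 (∑ i, (w i ^ 2).toNNReal)) = c * √(∑ i, w i ^ 2) := by
    have hv : ∑ i, (w i ^ 2).toNNReal = ((√(∑ i, w i ^ 2)) ^ 2).toNNReal := by
      rw [Real.sq_sqrt hσ, Real.toNNReal_sum_of_nonneg fun i _ => sq_nonneg _]
    have := integral_abs_pow_gaussianReal (√(∑ i, w i ^ 2)) 1
    simp only [pow_one] at this
    rw [hv, this, abs_of_nonneg (Real.sqrt_nonneg _), integral_abs_gaussianReal_zero_one, mul_comm]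
  rw [hG] at h2
  have hfin : |∫ ω, |S ω| ∂P - c * √(∑ i, w i ^ 2)|
      ≤ 1 + ∑ i, 3 * (M ^ 3 + ∫ x, |x| ^ 3 ∂(gaussianReal 0 1)) * |w i| ^ 3 := by
    rw [abs_le] at main ⊢
    constructor <;> linarith [main.1, main.2, h1.1, h1.2, h2.1, h2.2]
  have hSu : ∫ ω, |∑ i, u i * a i ω| ∂P = ε * ∫ ω, |S ω| ∂P := by
    rw [← integral_const_mul]
    refine integral_congr_ae (ae_of_all _ fun ω => ?_)
    simp only [hS, hw]
    nth_rewrite 1 [← abs_of_pos hε]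
    rw [← abs_mul, Finset.mul_sum]
    congr 1
    refine Finset.sum_congr rfl fun i _ => ?_
    field_simp
  have hwu : √(∑ i, u i ^ 2) = ε * √(∑ i, w i ^ 2) := by
    nth_rewrite 1 [← Real.sqrt_sq hε.le]
    rw [← Real.sqrt_mul (by positivity), Finset.mul_sum]
    congr 1
    refine Finset.sum_congr rfl fun i _ => ?_
    simp only [hw]
    field_simp
  rw [hSu, hwu, show ε * ∫ ω, |S ω| ∂P - c * (ε * √(∑ i, w i ^ 2))
    = ε * (∫ ω, |S ω| ∂P - c * √(∑ i, w i ^ 2)) by ring, abs_mul, abs_of_pos hε]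
  refine (mul_le_mul_of_nonneg_left hfin hε.le).trans ?_
  rw [mul_add, ← Finset.mul_sum]
  have h3 : ∑ i, |w i| ^ 3 = (∑ i, |u i| ^ 3) / ε ^ 3 := by
    rw [Finset.sum_div]
    refine Finset.sum_congr rfl fun i _ => ?_
    simp only [hw, abs_div, abs_of_pos hε, div_pow]
  rw [h3]
  refine add_le_add (by linarith) (le_of_eq ?_)
  field_simp

end Column

/-! ### Continuous images, partial integrals and mean absolute values -/

theorem IsBddMeasurable.continuous_comp {Ω : Type*} [MeasurableSpace Ω] {X : Ω → ℝ}
    (hX : IsBddMeasurable X) {g : ℝ → ℝ} (hg : Continuous g) :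
    IsBddMeasurable (fun ω => g (X ω)) := by
  obtain ⟨mX, C, hC⟩ := hX
  obtain ⟨D, hD⟩ := (isCompact_Icc (a := -C) (b := C)).exists_bound_of_continuousOn hg.continuousOn
  exact ⟨hg.measurable.comp mX, D, fun ω => hD _ (abs_le.1 (hC ω))⟩

theorem IsBddMeasurable.integral_right {Ω Ω' : Type*} [MeasurableSpace Ω] [MeasurableSpace Ω']
    {Q : Measure Ω'} [IsProbabilityMeasure Q] {F : Ω × Ω' → ℝ} (hF : IsBddMeasurable F) :
    IsBddMeasurable (fun ω => ∫ ω', F (ω, ω') ∂Q) := by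
  obtain ⟨mF, C, hC⟩ := hF
  refine ⟨mF.stronglyMeasurable.integral_prod_right'.measurable, C, fun ω => ?_⟩
  have := norm_integral_le_of_norm_le_const (μ := Q) (f := fun ω' => F (ω, ω')) (C := C)
    (ae_of_all _ fun ω' => hC (ω, ω'))
  simpa using this

theorem integral_abs_le_sqrt_of_memLp {Ω : Type*} [MeasurableSpace Ω] {P : Measure Ω}
    [IsProbabilityMeasure P] {X : Ω → ℝ} (hX : MemLp X 2 P) {B : ℝ}
    (hB : ∫ ω, X ω ^ 2 ∂P ≤ B) : ∫ ω, |X ω| ∂P ≤ √B := by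
  refine Real.le_sqrt_of_sq_le (le_trans ?_ hB)
  have h := variance_nonneg (fun ω => |X ω|) P
  rw [variance_eq_sub (by simpa using hX.norm)] at h
  simpa using h

theorem IsBddMeasurable.integral_abs_le_sqrt {Ω : Type*} [MeasurableSpace Ω] {P : Measure Ω}
    [IsProbabilityMeasure P] {X : Ω → ℝ} (hX : IsBddMeasurable X) {B : ℝ}
    (hB : ∫ ω, X ω ^ 2 ∂P ≤ B) : ∫ ω, |X ω| ∂P ≤ √B :=
  integral_abs_le_sqrt_of_memLp (hX.memLp 2) hB

/-! ### One normalised layer -/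

/-- The row vector `u` times the matrix `a`, divided by the square root of the size of `u`. -/
noncomputable def normStep {ι κ : Type*} [Fintype ι] (u : ι → ℝ) (a : ι → κ → ℝ) (j : κ) : ℝ :=
  (√(Fintype.card ι))⁻¹ * ∑ i, u i * a i j

/-- The mean of the squares of the entries of a vector. -/
noncomputable def meanSq {ι : Type*} [Fintype ι] (u : ι → ℝ) : ℝ :=
  (Fintype.card ι : ℝ)⁻¹ * ∑ i, u i ^ 2

/-- The mean of the absolute values of the entries of a vector. -/
noncomputable def meanAbs {ι : Type*} [Fintype ι] (u : ι → ℝ) : ℝ :=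
  (Fintype.card ι : ℝ)⁻¹ * ∑ i, |u i|

/-- A random matrix with independent, centred, normalised and bounded entries. -/
structure IsBddLayer {Ω ι κ : Type*} [MeasurableSpace Ω] (P : Measure Ω) (a : Ω → ι → κ → ℝ)
    (M : ℝ) : Prop where
  indep : iIndepFun (fun (e : ι × κ) ω => a ω e.1 e.2) P
  meas : ∀ i j, Measurable fun ω => a ω i j
  bdd : ∀ i j ω, |a ω i j| ≤ M
  mean : ∀ i j, ∫ ω, a ω i j ∂P = 0
  var : ∀ i j, ∫ ω, a ω i j ^ 2 ∂P = 1

section Layer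

variable {Ω ι κ : Type*} [MeasurableSpace Ω] [Fintype ι] {P : Measure Ω}
  [IsProbabilityMeasure P] {a : Ω → ι → κ → ℝ} {M : ℝ} {U : Ω → ι → ℝ}

theorem measurable_normStep (j : κ) :
    Measurable fun p : (ι → ℝ) × (ι → κ → ℝ) => normStep p.1 p.2 j := by
  unfold normStep; fun_prop

namespace IsBddLayer

omit [Fintype ι] [IsProbabilityMeasure P] in
theorem isBddMeasurable (ha : IsBddLayer P a M) (i : ι) (j : κ) :
    IsBddMeasurable fun ω => a ω i j := ⟨ha.meas i j, M, ha.bdd i j⟩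

omit [Fintype ι] [IsProbabilityMeasure P] in
theorem measurable (ha : IsBddLayer P a M) : Measurable a :=
  measurable_pi_iff.2 fun i => measurable_pi_iff.2 fun j => ha.meas i j

omit [IsProbabilityMeasure P] in
theorem isBddMeasurable_normStep (ha : IsBddLayer P a M)
    (hU : ∀ i, IsBddMeasurable fun ω => U ω i) (j : κ) :
    IsBddMeasurable fun ω => normStep (U ω) (a ω) j :=
  (IsBddMeasurable.sum fun i _ => (hU i).mul (ha.isBddMeasurable i j)).const_mul _

omit [IsProbabilityMeasure P] in
theorem isBddMeasurable_normStep_prod (ha : IsBddLayer P a M)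
    (hU : ∀ i, IsBddMeasurable fun ω => U ω i) (j : κ) :
    IsBddMeasurable fun p : Ω × Ω => normStep (U p.1) (a p.2) j :=
  (IsBddMeasurable.sum fun i _ => ((hU i).comp measurable_fst).mul
    ((ha.isBddMeasurable i j).comp measurable_snd)).const_mul _

omit [IsProbabilityMeasure P] in
theorem isBddMeasurable_normStep_const (ha : IsBddLayer P a M) (u : ι → ℝ) (j : κ) :
    IsBddMeasurable fun ω => normStep u (a ω) j :=
  ha.isBddMeasurable_normStep (U := fun _ => u) (fun _ => IsBddMeasurable.const _) j

omit [Fintype ι] [IsProbabilityMeasure P] in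
theorem iIndepFun_column (ha : IsBddLayer P a M) (j : κ) :
    iIndepFun (fun i ω => a ω i j) P :=
  ha.indep.precomp (g := fun i => (i, j)) fun _ _ h => (Prod.mk.inj h).1

theorem moments_normStep (ha : IsBddLayer P a M) (hM : 3 ≤ M ^ 2) (u : ι → ℝ) (j : κ) :
    ∫ ω, normStep u (a ω) j ^ 2 ∂P = meanSq u ∧
      ∫ ω, normStep u (a ω) j ^ 4 ∂P ≤ M ^ 2 * ((Fintype.card ι : ℝ)⁻¹ * ∑ i, u i ^ 4) := by
  have hb (i) : IsBddMeasurable fun ω => u i * a ω i j := (ha.isBddMeasurable i j).const_mul _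
  obtain ⟨-, h2, h4⟩ := moments_sum_of_iIndepFun (P := P) (X := fun i ω => u i * a ω i j) (u := u)
    ((ha.iIndepFun_column j).comp (fun i x => u i * x) fun i => by fun_prop) hb
    (fun i => by rw [integral_const_mul, ha.mean, mul_zero]) hM
    (fun i => by simp_rw [mul_pow]; rw [integral_const_mul, ha.var, mul_one])
    (fun i => by
      simp_rw [mul_pow]
      rw [integral_const_mul, mul_comm]
      gcongr
      calc ∫ ω, a ω i j ^ 4 ∂P ≤ ∫ ω, M ^ 2 * a ω i j ^ 2 ∂P := by
            refine integral_mono ((ha.isBddMeasurable i j).pow 4).integrable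
              (((ha.isBddMeasurable i j).pow 2).const_mul _).integrable fun ω => ?_
            have := pow_le_pow_left₀ (abs_nonneg _) (ha.bdd i j ω) 2
            rw [sq_abs] at this
            nlinarith [sq_nonneg (a ω i j)]
        _ = M ^ 2 := by rw [integral_const_mul, ha.var, mul_one]) Finset.univ
  have hc : (√(Fintype.card ι : ℝ)) ^ 2 = Fintype.card ι := Real.sq_sqrt (Nat.cast_nonneg _)
  simp_rw [normStep, mul_pow, integral_const_mul]
  refine ⟨by rw [h2, inv_pow, hc, meanSq], ?_⟩
  rw [inv_pow, show (√(Fintype.card ι : ℝ)) ^ 4 = (Fintype.card ι : ℝ) ^ 2 by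
    rw [← hc, ← pow_mul, hc]]
  -- Cauchy–Schwarz makes the bound linear in the fourth powers of `u`, so it can be integrated once
  -- `u` is random.
  have hcs := sq_sum_le_card_mul_sum_sq (s := Finset.univ) (f := fun i => u i ^ 2)
  simp only [Finset.card_univ, ← pow_mul] at hcs
  calc ((Fintype.card ι : ℝ) ^ 2)⁻¹ * ∫ ω, (∑ i, u i * a ω i j) ^ 4 ∂P
      ≤ ((Fintype.card ι : ℝ) ^ 2)⁻¹ * (M ^ 2 * (Fintype.card ι * ∑ i, u i ^ 4)) := by
        gcongr
        exact h4.trans (by gcongr)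
    _ = _ := by
        rcases eq_or_ne (Fintype.card ι : ℝ) 0 with h | h
        · simp [h]
        · field_simp

/-- The weights `u i` / √n have sum of cubes n^(-1/2) times the mean of |u|³: the factor n^(-1/2) is
what makes the Gaussian approximation improve with the size. -/
theorem abs_integral_abs_normStep_sub_le [Nonempty ι] (ha : IsBddLayer P a M) (u : ι → ℝ) (j : κ)
    {ε : ℝ} (hε : 0 < ε) :
    |∫ ω, |normStep u (a ω) j| ∂P - √(2 / Real.pi) * √(meanSq u)|
      ≤ 2 * ε + 3 * (M ^ 3 + ∫ x, |x| ^ 3 ∂(gaussianReal 0 1)) / ε ^ 2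
        * ((√(Fintype.card ι))⁻¹ * ((Fintype.card ι : ℝ)⁻¹ * ∑ i, |u i| ^ 3)) := by
  have hc : (√(Fintype.card ι : ℝ)) ^ 2 = Fintype.card ι := Real.sq_sqrt (Nat.cast_nonneg _)
  have := abs_integral_abs_sum_sub_le (ha.iIndepFun_column j) (fun i => ha.meas i j)
    (fun i => ha.bdd i j) (fun i => ha.mean i j) (fun i => ha.var i j)
    (fun i => (√(Fintype.card ι : ℝ))⁻¹ * u i) hε
  simp only [mul_pow, abs_mul, ← Finset.mul_sum, mul_assoc] at this
  simp only [normStep, meanSq]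
  rw [inv_pow, hc] at this
  have h3 : |(√(Fintype.card ι : ℝ))⁻¹| ^ 3 = (√(Fintype.card ι))⁻¹ * (Fintype.card ι : ℝ)⁻¹ := by
    rw [abs_of_nonneg (by positivity), ← hc, ← inv_pow, hc]
    ring
  rw [h3] at this
  simpa only [mul_assoc, abs_mul] using this

variable (hU : ∀ i, IsBddMeasurable fun ω => U ω i) (hUa : IndepFun U a P)

include hU hUa in
theorem integral_comp_normStep (ha : IsBddLayer P a M) {g : ℝ → ℝ} (hg : Continuous g) (j : κ) :
    ∫ ω, g (normStep (U ω) (a ω) j) ∂P = ∫ ω, ∫ ω', g (normStep (U ω) (a ω') j) ∂P ∂P :=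
  integral_indepFun_eq_integral_integral hUa (measurable_pi_iff.2 fun i => (hU i).1) ha.measurable
    (F := fun p => g (normStep p.1 p.2 j)) (hg.measurable.comp (measurable_normStep j))
    ((ha.isBddMeasurable_normStep hU j).continuous_comp hg).integrable

include hU hUa in
theorem integral_normStep_pow_four_le (ha : IsBddLayer P a M) (hM : 3 ≤ M ^ 2) {R : ℝ}
    (hR : ∀ i, ∫ ω, U ω i ^ 4 ∂P ≤ R) (hR0 : 0 ≤ R) (j : κ) :
    ∫ ω, normStep (U ω) (a ω) j ^ 4 ∂P ≤ M ^ 2 * R := by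
  rw [ha.integral_comp_normStep hU hUa (g := fun x => x ^ 4) (by fun_prop)]
  have hb : IsBddMeasurable fun ω => M ^ 2 * ((Fintype.card ι : ℝ)⁻¹ * ∑ i, U ω i ^ 4) :=
    ((IsBddMeasurable.sum fun i _ => (hU i).pow 4).const_mul _).const_mul _
  refine (integral_mono (((ha.isBddMeasurable_normStep_prod hU j).pow 4).integral_right).integrable
    hb.integrable fun ω => (ha.moments_normStep hM (U ω) j).2).trans ?_
  rw [integral_const_mul, integral_const_mul, integral_finsetSum _ fun i _ =>
    ((hU i).pow 4).integrable]
  gcongr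
  calc (Fintype.card ι : ℝ)⁻¹ * ∑ i, ∫ ω, U ω i ^ 4 ∂P
      ≤ (Fintype.card ι : ℝ)⁻¹ * ∑ _i : ι, R := by gcongr with i; exact hR i
    _ ≤ R := by
      rcases eq_or_ne (Fintype.card ι : ℝ) 0 with h | h
      · simp [h, hR0]
      · simp [h]

include hU hUa in
/-- A conditional law of large numbers in mean square. -/
theorem integral_sq_mean_sub_le [Fintype κ] (ha : IsBddLayer P a M) {g : ℝ → ℝ}
    (hg : Continuous g) :
    ∫ ω, ((Fintype.card κ : ℝ)⁻¹ * ∑ j, (g (normStep (U ω) (a ω) j)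
        - ∫ ω', g (normStep (U ω) (a ω') j) ∂P)) ^ 2 ∂P
      ≤ ((Fintype.card κ : ℝ)⁻¹) ^ 2 * ∑ j, ∫ ω, g (normStep (U ω) (a ω) j) ^ 2 ∂P := by
  have hmU : Measurable U := measurable_pi_iff.2 fun i => (hU i).1
  have hgb (j) := (ha.isBddMeasurable_normStep hU j).continuous_comp hg
  have hgp (j) := (ha.isBddMeasurable_normStep_prod hU j).continuous_comp hg
  have hgc (u) (j) := (ha.isBddMeasurable_normStep_const u j).continuous_comp hg
  have hh (j) : Measurable fun u : ι → ℝ => ∫ ω', g (normStep u (a ω') j) ∂P := by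
    have : Measurable fun p : (ι → ℝ) × Ω => g (normStep p.1 (a p.2) j) :=
      hg.measurable.comp ((measurable_normStep j).comp
        (measurable_fst.prodMk (ha.measurable.comp measurable_snd)))
    exact this.stronglyMeasurable.integral_prod_right'.measurable
  have hF : Measurable fun p : (ι → ℝ) × (ι → κ → ℝ) =>
      (∑ j, (g (normStep p.1 p.2 j) - ∫ ω', g (normStep p.1 (a ω') j) ∂P)) ^ 2 := by
    refine Measurable.pow_const (Finset.measurable_sum _ fun j _ => ?_) 2
    exact (hg.measurable.comp (measurable_normStep j)).sub ((hh j).comp measurable_fst)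
  -- For frozen `u`, distinct outputs depend on disjoint columns, so the variance of the sum is the
  -- sum of the variances.
  have hfix (u : ι → ℝ) : ∫ ω', (∑ j, (g (normStep u (a ω') j)
      - ∫ ω', g (normStep u (a ω') j) ∂P)) ^ 2 ∂P ≤ ∑ j, ∫ ω', g (normStep u (a ω') j) ^ 2 ∂P := by
    have hv := IndepFun.variance_sum (μ := P) (s := Finset.univ)
      (X := fun j ω' => g (normStep u (a ω') j)) (fun j _ => (hgc u j).memLp 2)
      fun j _ k _ hjk => by
        have := iIndepFun_indepFun_of_disjoint_range ha.indep (fun e => ha.meas e.1 e.2)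
          (fun i : ι => (i, j)) (fun i : ι => (i, k)) fun i i' h => hjk (Prod.mk.inj h).2
        exact this.comp (φ := fun x => g ((√(Fintype.card ι))⁻¹ * ∑ i, u i * x i))
          (ψ := fun x => g ((√(Fintype.card ι))⁻¹ * ∑ i, u i * x i))
          (hg.measurable.comp (by fun_prop)) (hg.measurable.comp (by fun_prop))
    rw [variance_eq_integral (Finset.aemeasurable_sum _ fun j _ => (hgc u j).1.aemeasurable)] at hv
    simp only [Finset.sum_apply] at hv
    rw [integral_finsetSum _ fun j _ => (hgc u j).integrable] at hv
    simp only [← Finset.sum_sub_distrib] at hv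
    rw [hv]
    refine Finset.sum_le_sum fun j _ => ?_
    have := variance_le_expectation_sq (hgc u j).1.aestronglyMeasurable (μ := P)
    simpa using this
  simp_rw [mul_pow, integral_const_mul]
  gcongr
  have hDb := IsBddMeasurable.sum (s := Finset.univ) fun j _ => (hgb j).sub ((hgp j).integral_right (Q := P))
  have hDp : IsBddMeasurable fun p : Ω × Ω => (∑ j, (g (normStep (U p.1) (a p.2) j)
      - ∫ ω', g (normStep (U p.1) (a ω') j) ∂P)) ^ 2 :=
    (IsBddMeasurable.sum fun j _ => (hgp j).sub
      ((hgp j).integral_right.comp measurable_fst)).pow 2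
  rw [integral_indepFun_eq_integral_integral hUa hmU ha.measurable hF (hDb.pow 2).integrable]
  refine (integral_mono hDp.integral_right.integrable (IsBddMeasurable.sum fun j _ =>
    ((hgp j).pow 2).integral_right).integrable fun ω => hfix (U ω)).trans (le_of_eq ?_)
  rw [integral_finsetSum _ fun j _ => ((hgp j).pow 2).integral_right.integrable]
  exact Finset.sum_congr rfl fun j _ =>
    (ha.integral_comp_normStep hU hUa (g := fun x => g x ^ 2) (by fun_prop) j).symm

-- The conditional mean of each squared output is `meanSq (U ω)`, so the law of large numbers with
-- g(x) = x² bounds the change of `meanSq` over the layer. The factors 2 come from (a + b)² ≤ 2a² +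
-- 2b².
include hU hUa in
theorem integral_sq_meanSq_normStep_sub_one_le [Fintype κ] [Nonempty κ] (ha : IsBddLayer P a M)
    (hM : 3 ≤ M ^ 2) {R S : ℝ} (hR : ∀ i, ∫ ω, U ω i ^ 4 ∂P ≤ R) (hR0 : 0 ≤ R)
    (hS : ∫ ω, (meanSq (U ω) - 1) ^ 2 ∂P ≤ S) :
    ∫ ω, (meanSq (normStep (U ω) (a ω)) - 1) ^ 2 ∂P
      ≤ 2 * (M ^ 2 * R / Fintype.card κ) + 2 * S := by
  have hκ : (Fintype.card κ : ℝ) ≠ 0 := by simp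
  have h := ha.integral_sq_mean_sub_le hU hUa (g := fun x => x ^ 2) (by fun_prop)
  simp_rw [fun u j => (ha.moments_normStep hM u j).1] at h
  have e (ω) : (Fintype.card κ : ℝ)⁻¹ * ∑ j, (normStep (U ω) (a ω) j ^ 2 - meanSq (U ω))
      = meanSq (normStep (U ω) (a ω)) - meanSq (U ω) := by
    rw [Finset.sum_sub_distrib, mul_sub, ← meanSq]
    simp [hκ]
  simp_rw [e, ← pow_mul] at h
  have h4 : ((Fintype.card κ : ℝ)⁻¹) ^ 2 * ∑ j, ∫ ω, normStep (U ω) (a ω) j ^ (2 * 2) ∂P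
      ≤ M ^ 2 * R / Fintype.card κ := by
    calc _ ≤ ((Fintype.card κ : ℝ)⁻¹) ^ 2 * ∑ _j : κ, M ^ 2 * R := by
          gcongr with j
          exact ha.integral_normStep_pow_four_le hU hUa hM hR hR0 j
      _ = _ := by
          simp only [Finset.sum_const, Finset.card_univ, nsmul_eq_mul]
          field_simp
  have hsU : IsBddMeasurable fun ω => meanSq (U ω) :=
    (IsBddMeasurable.sum fun i _ => (hU i).pow 2).const_mul _
  have hsV : IsBddMeasurable fun ω => meanSq (normStep (U ω) (a ω)) :=
    (IsBddMeasurable.sum fun j _ => (ha.isBddMeasurable_normStep hU j).pow 2).const_mul _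
  have h1 := ((hsV.sub hsU).pow 2).const_mul 2
  have h2 := ((hsU.sub (IsBddMeasurable.const 1)).pow 2).const_mul 2
  calc _ ≤ ∫ ω, (2 * (meanSq (normStep (U ω) (a ω)) - meanSq (U ω)) ^ 2
        + 2 * (meanSq (U ω) - 1) ^ 2) ∂P := by
        refine integral_mono ((hsV.sub (IsBddMeasurable.const 1)).pow 2).integrable
          (h1.add h2).integrable fun ω => ?_
        change (meanSq (normStep (U ω) (a ω)) - 1) ^ 2 ≤ _
        nlinarith [sq_nonneg (meanSq (normStep (U ω) (a ω)) - meanSq (U ω)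
          - (meanSq (U ω) - 1))]
    _ ≤ _ := by
        rw [integral_add h1.integrable h2.integrable, integral_const_mul, integral_const_mul]
        linarith [h.trans h4]

-- Three errors add up: the fluctuation `D` of the average over outputs, the Gaussian approximation
-- error `E`, and the deviation of √`meanSq` from 1, controlled by |√s − 1| ≤ |s − 1|.
include hU hUa in
theorem integral_abs_meanAbs_normStep_sub_le [Nonempty ι] [Fintype κ] [Nonempty κ]
    (ha : IsBddLayer P a M) (hM : 3 ≤ M ^ 2) {R S : ℝ} (hR : ∀ i, ∫ ω, U ω i ^ 4 ∂P ≤ R)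
    (hR0 : 0 ≤ R) (hS : ∫ ω, (meanSq (U ω) - 1) ^ 2 ∂P ≤ S) (hM0 : 0 ≤ M) {ε : ℝ} (hε : 0 < ε) :
    ∫ ω, |meanAbs (normStep (U ω) (a ω)) - √(2 / Real.pi)| ∂P
      ≤ √((1 + M ^ 2 * R) / Fintype.card κ) + (2 * ε +
        3 * (M ^ 3 + ∫ x, |x| ^ 3 ∂(gaussianReal 0 1)) / ε ^ 2
          * ((√(Fintype.card ι))⁻¹ * (1 + R))) + √(2 / Real.pi) * √S := by
  set c := √(2 / Real.pi) with hcdef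
  set G := 3 * (M ^ 3 + ∫ x, |x| ^ 3 ∂(gaussianReal 0 1)) / ε ^ 2 with hG
  have hG0 : 0 ≤ G := by
    have : 0 ≤ ∫ x, |x| ^ 3 ∂(gaussianReal 0 1) := integral_nonneg fun x => by positivity
    positivity
  have hκ : (Fintype.card κ : ℝ) ≠ 0 := by simp
  have hι : (Fintype.card ι : ℝ) ≠ 0 := by simp
  have hcont : Continuous fun x : ℝ => |x| := continuous_abs
  have hV (j) := ha.isBddMeasurable_normStep hU j
  have hgp (j) := (ha.isBddMeasurable_normStep_prod hU j).abs
  set D : Ω → ℝ := fun ω => (Fintype.card κ : ℝ)⁻¹ * ∑ j, (|normStep (U ω) (a ω) j|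
        - ∫ ω', |normStep (U ω) (a ω') j| ∂P) with hD
  set E : Ω → ℝ := fun ω => (Fintype.card κ : ℝ)⁻¹ * ∑ j,
    (∫ ω', |normStep (U ω) (a ω') j| ∂P - c * √(meanSq (U ω))) with hE
  have hDb : IsBddMeasurable D :=
    (IsBddMeasurable.sum fun j _ => (hV j).abs.sub (hgp j).integral_right).const_mul _
  have hsU : IsBddMeasurable fun ω => meanSq (U ω) :=
    (IsBddMeasurable.sum fun i _ => (hU i).pow 2).const_mul _
  have hEb : IsBddMeasurable E :=
    (IsBddMeasurable.sum fun j _ => (hgp j).integral_right.sub (hsU.sqrt.const_mul c)).const_mul _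
  have hs1 := hsU.sub (IsBddMeasurable.const 1)
  have hdec (ω) : meanAbs (normStep (U ω) (a ω)) - c
      = D ω + E ω + c * (√(meanSq (U ω)) - 1) := by
    simp only [hD, hE, ← mul_add, ← Finset.sum_add_distrib, sub_add_sub_cancel]
    rw [Finset.sum_sub_distrib, mul_sub, ← meanAbs]
    simp [hκ]
    ring
  have b1 : ∫ ω, |D ω| ∂P ≤ √((1 + M ^ 2 * R) / Fintype.card κ) := by
    refine hDb.integral_abs_le_sqrt ((ha.integral_sq_mean_sub_le hU hUa hcont).trans ?_)
    simp only [sq_abs]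
    calc _ ≤ ((Fintype.card κ : ℝ)⁻¹) ^ 2 * ∑ _j : κ, (1 + M ^ 2 * R) := by
          gcongr with j
          calc ∫ ω, normStep (U ω) (a ω) j ^ 2 ∂P
              ≤ ∫ ω, (1 + normStep (U ω) (a ω) j ^ 4) ∂P := by
                refine integral_mono ((hV j).pow 2).integrable
                  ((IsBddMeasurable.const 1).add ((hV j).pow 4)).integrable fun ω => ?_
                nlinarith [sq_nonneg (normStep (U ω) (a ω) j ^ 2 - 1),
                  sq_nonneg (normStep (U ω) (a ω) j)]
            _ ≤ _ := by
                rw [integral_add (integrable_const _) ((hV j).pow 4).integrable]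
                have := ha.integral_normStep_pow_four_le hU hUa hM hR hR0 j
                simpa using this
      _ = _ := by
          simp only [Finset.sum_const, Finset.card_univ, nsmul_eq_mul]
          field_simp
  have hU3 : IsBddMeasurable fun ω => (Fintype.card ι : ℝ)⁻¹ * ∑ i, |U ω i| ^ 3 :=
    (IsBddMeasurable.sum fun i _ => (hU i).abs.pow 3).const_mul _
  have hbd := (IsBddMeasurable.const (2 * ε)).add ((hU3.const_mul (√(Fintype.card ι))⁻¹).const_mul G)
  have b2 : ∫ ω, |E ω| ∂P ≤ 2 * ε + G * ((√(Fintype.card ι))⁻¹ * (1 + R)) := by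
    calc ∫ ω, |E ω| ∂P ≤ ∫ ω, (2 * ε + G * ((√(Fintype.card ι))⁻¹
          * ((Fintype.card ι : ℝ)⁻¹ * ∑ i, |U ω i| ^ 3))) ∂P := by
          refine integral_mono hEb.abs.integrable hbd.integrable fun ω => ?_
          simp only [hE]
          rw [abs_mul, abs_of_nonneg (by positivity)]
          calc _ ≤ (Fintype.card κ : ℝ)⁻¹ * ∑ _j : κ, (2 * ε + G * ((√(Fintype.card ι))⁻¹
                * ((Fintype.card ι : ℝ)⁻¹ * ∑ i, |U ω i| ^ 3))) := by
                gcongr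
                refine (Finset.abs_sum_le_sum_abs _ _).trans (Finset.sum_le_sum fun j _ => ?_)
                exact ha.abs_integral_abs_normStep_sub_le (U ω) j hε
            _ = _ := by
              simp only [Finset.sum_const, Finset.card_univ, nsmul_eq_mul]
              field_simp
      _ ≤ _ := by
          rw [integral_add (integrable_const _)
            ((hU3.const_mul (√(Fintype.card ι))⁻¹).const_mul G).integrable, integral_const,
            integral_const_mul, integral_const_mul, integral_const_mul,
            integral_finsetSum _ fun i _ => ((hU i).abs.pow 3).integrable]
          simp only [probReal_univ, one_smul]
          gcongr
          calc _ ≤ (Fintype.card ι : ℝ)⁻¹ * ∑ _i : ι, (1 + R) := by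
                gcongr with i
                calc ∫ ω, |U ω i| ^ 3 ∂P ≤ ∫ ω, (1 + U ω i ^ 4) ∂P := by
                      refine integral_mono ((hU i).abs.pow 3).integrable
                        ((IsBddMeasurable.const 1).add ((hU i).pow 4)).integrable fun ω => ?_
                      have h4 : U ω i ^ 4 = |U ω i| ^ 4 := by
                        rw [← abs_pow, abs_of_nonneg (by positivity)]
                      simp only [h4]
                      rcases le_total |U ω i| 1 with h | h
                      · have := pow_le_one₀ (n := 3) (abs_nonneg _) h
                        have : 0 ≤ |U ω i| ^ 4 := by positivity
                        linarith
                      · have := pow_le_pow_right₀ h (show 3 ≤ 4 by norm_num)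
                        linarith
                  _ ≤ _ := by
                      rw [integral_add (integrable_const _) ((hU i).pow 4).integrable]
                      simpa using hR i
            _ = _ := by
                simp only [Finset.sum_const, Finset.card_univ, nsmul_eq_mul]
                field_simp
  have b3 : ∫ ω, |c * (√(meanSq (U ω)) - 1)| ∂P ≤ c * √S := by
    simp_rw [abs_mul]
    rw [integral_const_mul, abs_of_nonneg (Real.sqrt_nonneg _)]
    gcongr
    refine le_trans ?_ (hs1.integral_abs_le_sqrt hS)
    refine integral_mono (hsU.sqrt.sub (IsBddMeasurable.const 1)).abs.integrable
      hs1.abs.integrable fun ω => ?_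
    have h0 : 0 ≤ meanSq (U ω) := mul_nonneg (by positivity)
      (Finset.sum_nonneg fun i _ => sq_nonneg _)
    have hs := Real.sq_sqrt h0
    have : meanSq (U ω) - 1 = (√(meanSq (U ω)) - 1) * (√(meanSq (U ω)) + 1) := by
      linear_combination -hs
    change |√(meanSq (U ω)) - 1| ≤ |meanSq (U ω) - 1|
    rw [this, abs_mul]
    refine le_mul_of_one_le_right (abs_nonneg _) ?_
    have := Real.sqrt_nonneg (meanSq (U ω))
    rw [abs_of_nonneg (by linarith)]
    linarith
  have hCb := (hsU.sqrt.sub (IsBddMeasurable.const 1)).const_mul c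
  simp_rw [hdec]
  calc _ ≤ ∫ ω, (|D ω| + |E ω| + |c * (√(meanSq (U ω)) - 1)|) ∂P := by
        refine integral_mono ((hDb.add hEb).add hCb).abs.integrable
          ((hDb.abs.add hEb.abs).add hCb.abs).integrable fun ω => ?_
        exact (abs_add_le _ _).trans (add_le_add_left (abs_add_le _ _) _)
    _ ≤ _ := by
        rw [integral_add (hDb.abs.add hEb.abs).integrable hCb.abs.integrable,
          integral_add hDb.abs.integrable hEb.abs.integrable]
        linarith

end IsBddLayer

end Layer

/-! ### Products of matrices applied to the vector of ones -/

theorem linftyOperatorNorm_eq {m n : ℕ} (A : Matrix (Fin m) (Fin n) ℝ) :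
    linftyOperatorNorm A = ((Finset.univ : Finset (Fin m)).sup fun i => ∑ j, ‖A i j‖₊ : NNReal) := by
  let := @Matrix.linftyOpNormedAddCommGroup (Fin m) (Fin n) ℝ _ _ _
  rw [← Matrix.linfty_opNorm_def, Matrix.linfty_opNorm_eq_opNorm]
  rfl

/-- All row sums of absolute values coincide, so the maximum over the nonempty set of rows is their
common value, whatever `m` is. -/
theorem linftyOperatorNorm_onesMatrix_mul {m n r : ℕ} (hm : 1 ≤ m) (A : Matrix (Fin n) (Fin r) ℝ) :
    linftyOperatorNorm (onesMatrix m n * A) = ∑ j, |∑ i, A i j| := by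
  have : Nonempty (Fin m) := ⟨⟨0, hm⟩⟩
  simp only [linftyOperatorNorm_eq, onesMatrix, Matrix.mul_apply, Matrix.of_apply, one_mul]
  rw [Finset.sup_const Finset.univ_nonempty]
  simp

/-- The normalised product `(n₀ ⋯ n_{p-1})^{-1/2} 𝟏 A⁽¹⁾ ⋯ A⁽ᵖ⁾`, computed one layer at a time. -/
noncomputable def chainVec : (p : ℕ) → (d : Fin (p + 1) → ℕ) →
    ((k : Fin p) → Matrix (Fin (d k.castSucc)) (Fin (d k.succ)) ℝ) → Fin (d (Fin.last p)) → ℝ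
  | 0, _, _ => fun _ => 1
  | p + 1, d, A =>
      normStep (chainVec p (fun i => d i.castSucc) fun k => A k.castSucc) (A (Fin.last p))

theorem sum_matrix_mul_apply {m n r : Type*} [Fintype m] [Fintype n] (B : Matrix m n ℝ)
    (C : Matrix n r ℝ) (j : r) : ∑ i, (B * C) i j = ∑ x, (∑ i, B i x) * C x j := by
  simp only [Matrix.mul_apply, Finset.sum_mul]
  exact Finset.sum_comm

theorem chainVec_eq (p : ℕ) (d : Fin (p + 1) → ℕ)
    (A : (k : Fin p) → Matrix (Fin (d k.castSucc)) (Fin (d k.succ)) ℝ) (j : Fin (d (Fin.last p))) :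
    chainVec p d A j
      = (∏ k : Fin p, (d k.castSucc : ℝ)) ^ (-(1 / 2) : ℝ) * ∑ i, chainProd p d A i j := by
  induction p with
  | zero =>
    simp only [chainVec, chainProd, Finset.univ_eq_empty, Finset.prod_empty, Real.one_rpow, one_mul]
    exact (by simp [Matrix.one_apply] : (1 : ℝ) =
      ∑ i, (1 : Matrix (Fin (d 0)) (Fin (d 0)) ℝ) i j)
  | succ p ih =>
    have hstep : chainVec (p + 1) d A j = (√(d (Fin.last p).castSucc : ℝ))⁻¹ * ∑ i,
        chainVec p (fun i => d i.castSucc) (fun k => A k.castSucc) i * A (Fin.last p) i j := by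
      rw [chainVec]
      unfold normStep
      rw [Fintype.card_fin]
    have hmul : ∑ i, chainProd (p + 1) d A i j = ∑ x, (∑ i, chainProd p (fun i => d i.castSucc)
        (fun k => A k.castSucc) i x) * A (Fin.last p) x j :=
      sum_matrix_mul_apply (chainProd p (fun i => d i.castSucc) fun k => A k.castSucc)
        (A (Fin.last p)) j
    rw [hstep, hmul, Fin.prod_univ_castSucc, Real.mul_rpow
      (Finset.prod_nonneg fun _ _ => Nat.cast_nonneg _) (Nat.cast_nonneg _),
      Real.rpow_neg (Nat.cast_nonneg _) (1 / 2), ← Real.sqrt_eq_rpow]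
    simp only [ih, mul_assoc]
    rw [← Finset.mul_sum, mul_left_comm]

theorem scaled_norm_eq_meanAbs_chainVec {p m : ℕ} (hm : 1 ≤ m) (d : Fin (p + 1) → ℕ)
    (A : (k : Fin p) → Matrix (Fin (d k.castSucc)) (Fin (d k.succ)) ℝ) :
    (d (Fin.last p) : ℝ)⁻¹ * (∏ k : Fin p, (d k.castSucc : ℝ)) ^ (-(1 / 2) : ℝ) *
      linftyOperatorNorm (onesMatrix m (d 0) * chainProd p d A) = meanAbs (chainVec p d A) := by
  have h : 0 ≤ (∏ k : Fin p, (d k.castSucc : ℝ)) ^ (-(1 / 2) : ℝ) :=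
    Real.rpow_nonneg (Finset.prod_nonneg fun _ _ => Nat.cast_nonneg _) _
  rw [linftyOperatorNorm_onesMatrix_mul hm, meanAbs, Fintype.card_fin, mul_assoc, Finset.mul_sum]
  simp_rw [chainVec_eq, abs_mul, abs_of_nonneg h]

theorem measurable_chainVec {α : Type*} [MeasurableSpace α] (p : ℕ) (d : Fin (p + 1) → ℕ)
    (A : (k : Fin p) → α → Matrix (Fin (d k.castSucc)) (Fin (d k.succ)) ℝ)
    (hA : ∀ k i j, Measurable fun x => A k x i j) :
    Measurable fun x => chainVec p d fun k => A k x := by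
  induction p with
  | zero => exact measurable_const
  | succ p ih =>
    refine measurable_pi_iff.2 fun j => ?_
    have h1 := ih (fun i => d i.castSucc) (fun k => A k.castSucc) fun k i j => hA _ i j
    have h2 : Measurable fun x i j => A (Fin.last p) x i j :=
      measurable_pi_iff.2 fun i => measurable_pi_iff.2 fun j => hA _ i j
    exact (measurable_normStep j).comp (h1.prodMk h2)

/-! ### Independence and moment bounds along the chain -/

section Chain

variable {Ω : Type*} [MeasurableSpace Ω] {P : Measure Ω}

theorem indepFun_prefix_last (p : ℕ) (d : Fin (p + 2) → ℕ)
    (A : (k : Fin (p + 1)) → Ω → Matrix (Fin (d k.castSucc)) (Fin (d k.succ)) ℝ)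
    (hA : ∀ k i j, Measurable fun ω => A k ω i j)
    (hindep : iIndepFun (fun (e : Σ k : Fin (p + 1), Fin (d k.castSucc) × Fin (d k.succ)) ω =>
      A e.1 ω e.2.1 e.2.2) P) :
    IndepFun (fun ω (e : Σ k : Fin p, Fin (d k.castSucc.castSucc) × Fin (d k.castSucc.succ)) =>
      A e.1.castSucc ω e.2.1 e.2.2) (fun ω i j => A (Fin.last p) ω i j) P := by
  have := iIndepFun_indepFun_of_disjoint_range hindep (fun e => hA e.1 e.2.1 e.2.2)
    (fun e : (Σ k : Fin p, Fin (d k.castSucc.castSucc) × Fin (d k.castSucc.succ)) =>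
      ⟨e.1.castSucc, e.2⟩)
    (fun e : Fin (d (Fin.last p).castSucc) × Fin (d (Fin.last p).succ) => ⟨Fin.last p, e⟩)
    fun k l h => (Fin.castSucc_ne_last k.1) (congrArg Sigma.fst h)
  exact this.comp (φ := id) (ψ := fun x i j => x (i, j)) measurable_id (by fun_prop)

theorem iIndepFun_prefix (p : ℕ) (d : Fin (p + 2) → ℕ)
    (A : (k : Fin (p + 1)) → Ω → Matrix (Fin (d k.castSucc)) (Fin (d k.succ)) ℝ)
    (hindep : iIndepFun (fun (e : Σ k : Fin (p + 1), Fin (d k.castSucc) × Fin (d k.succ)) ω =>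
      A e.1 ω e.2.1 e.2.2) P) :
    iIndepFun (fun (e : Σ k : Fin p, Fin (d k.castSucc.castSucc) × Fin (d k.castSucc.succ)) ω =>
      A e.1.castSucc ω e.2.1 e.2.2) P :=
  hindep.precomp
    (g := fun e : (Σ k : Fin p, Fin (d k.castSucc.castSucc) × Fin (d k.castSucc.succ)) =>
      (⟨e.1.castSucc, e.2⟩ : Σ k : Fin (p + 1), Fin (d k.castSucc) × Fin (d k.succ)))
    (by
      rintro ⟨k, x⟩ ⟨l, y⟩ h
      obtain rfl : k = l := Fin.castSucc_injective _ (congrArg Sigma.fst h)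
      simpa using h)

/-- The partial product is a measurable function of the finite array of earlier entries, which is
disjoint from the last matrix. -/
theorem indepFun_chainVec_last (p : ℕ) (d : Fin (p + 2) → ℕ)
    (A : (k : Fin (p + 1)) → Ω → Matrix (Fin (d k.castSucc)) (Fin (d k.succ)) ℝ)
    (hA : ∀ k i j, Measurable fun ω => A k ω i j)
    (hindep : iIndepFun (fun (e : Σ k : Fin (p + 1), Fin (d k.castSucc) × Fin (d k.succ)) ω =>
      A e.1 ω e.2.1 e.2.2) P) :
    IndepFun (fun ω => chainVec p (fun i => d i.castSucc) fun k => A k.castSucc ω)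
      (fun ω i j => A (Fin.last p) ω i j) P := by
  have h := measurable_chainVec p (fun i => d i.castSucc)
    (fun k (x : (Σ k : Fin p, Fin (d k.castSucc.castSucc) × Fin (d k.castSucc.succ)) → ℝ) =>
      (fun i j => x ⟨k, i, j⟩ : Matrix (Fin (d k.castSucc.castSucc)) (Fin (d k.castSucc.succ)) ℝ))
    fun k i j => measurable_pi_apply (⟨k, i, j⟩ :
        Σ k : Fin p, Fin (d k.castSucc.castSucc) × Fin (d k.castSucc.succ))
  exact (indepFun_prefix_last p d A hA hindep).comp h measurable_id

variable [IsProbabilityMeasure P]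

/-- The initial vector of ones has fourth moments 1 and `meanSq` exactly 1. A layer multiplies the
fourth-moment bound by M² and sends an error bound s for `meanSq` to 2M²R/N + 2s, where R is the
current fourth-moment bound. -/
theorem chainVec_bounds {M : ℝ} (hM : 3 ≤ M ^ 2) {N : ℕ} (hN : 1 ≤ N) (p : ℕ)
    (d : Fin (p + 1) → ℕ) (hd : ∀ q, N ≤ d q)
    (A : (k : Fin p) → Ω → Matrix (Fin (d k.castSucc)) (Fin (d k.succ)) ℝ)
    (hA : ∀ k, IsBddLayer P (fun ω i j => A k ω i j) M)
    (hindep : iIndepFun (fun (e : Σ k : Fin p, Fin (d k.castSucc) × Fin (d k.succ)) ω =>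
      A e.1 ω e.2.1 e.2.2) P) :
    (∀ j, IsBddMeasurable fun ω => chainVec p d (fun k => A k ω) j) ∧
      (∀ j, ∫ ω, chainVec p d (fun k => A k ω) j ^ 4 ∂P ≤ (M ^ 2) ^ p) ∧
      ∫ ω, (meanSq (chainVec p d fun k => A k ω) - 1) ^ 2 ∂P ≤ (4 * M ^ 2) ^ p / N := by
  induction p with
  | zero =>
    have h0 : (d 0 : ℝ) ≠ 0 := by
      have := hd 0
      exact_mod_cast (by omega : d 0 ≠ 0)
    refine ⟨fun j => IsBddMeasurable.const 1, fun j => by simp [chainVec], ?_⟩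
    simp only [chainVec, meanSq]
    simp [inv_mul_cancel₀ h0]
  | succ p ih =>
    obtain ⟨hb, h4, hs⟩ := ih (fun i => d i.castSucc) (fun q => hd _) (fun k => A k.castSucc)
      (fun k => hA k.castSucc) (iIndepFun_prefix p d A hindep)
    have hUa := indepFun_chainVec_last p d A (fun k i j => (hA k).meas i j) hindep
    have hl := hA (Fin.last p)
    have hR0 : 0 ≤ (M ^ 2) ^ p := by positivity
    have hdl : N ≤ d (Fin.last p).succ := hd _
    have : Nonempty (Fin (d (Fin.last p).succ)) := ⟨⟨0, by omega⟩⟩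
    refine ⟨hl.isBddMeasurable_normStep hb, fun j => ?_, ?_⟩
    · rw [pow_succ']
      exact hl.integral_normStep_pow_four_le hb hUa hM h4 hR0 j
    · refine (hl.integral_sq_meanSq_normStep_sub_one_le hb hUa hM h4 hR0 hs).trans ?_
      have hN0 : (0 : ℝ) < N := by exact_mod_cast hN
      have hdN : (N : ℝ) ≤ d (Fin.last p).succ := by exact_mod_cast hdl
      rw [Fintype.card_fin]
      have e1 : M ^ 2 * (M ^ 2) ^ p / d (Fin.last p).succ ≤ M ^ 2 * (M ^ 2) ^ p / N := by
        gcongr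
      -- The base 4M² is large enough to absorb both terms of the recursion.
      have e2 : 2 * (M ^ 2 * (M ^ 2) ^ p) + 2 * (4 * M ^ 2) ^ p ≤ (4 * M ^ 2) ^ (p + 1) := by
        generalize M ^ 2 = x at *
        have : (1 : ℝ) ≤ 4 ^ p := one_le_pow₀ (by norm_num)
        rw [mul_pow, mul_pow, pow_succ, pow_succ]
        nlinarith [mul_nonneg (mul_nonneg hR0 (sub_nonneg.2 this)) (by linarith : 0 ≤ x),
          mul_nonneg (mul_nonneg hR0 (by positivity : (0:ℝ) ≤ 4 ^ p)) (sub_nonneg.2 hM)]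
      calc _ ≤ 2 * (M ^ 2 * (M ^ 2) ^ p / N) + 2 * ((4 * M ^ 2) ^ p / N) := by linarith
        _ = (2 * (M ^ 2 * (M ^ 2) ^ p) + 2 * (4 * M ^ 2) ^ p) / N := by ring
        _ ≤ _ := by gcongr

end Chain

/-- Convergence in mean of the normalised `ℓ¹` norm, for bounded entries. -/
theorem exists_integral_abs_meanAbs_chainVec_sub_le.{u} (p : ℕ) {M : ℝ} (hM0 : 0 ≤ M)
    (hM : 3 ≤ M ^ 2) {η : ℝ} (hη : 0 < η) :
    ∃ N : ℕ, 1 ≤ N ∧ ∀ d : Fin (p + 2) → ℕ, (∀ q, N ≤ d q) → ∀ {Ω : Type u} [MeasurableSpace Ω]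
      (P : Measure Ω) [IsProbabilityMeasure P]
      (A : (k : Fin (p + 1)) → Ω → Matrix (Fin (d k.castSucc)) (Fin (d k.succ)) ℝ),
      (∀ k, IsBddLayer P (fun ω i j => A k ω i j) M) →
      iIndepFun (fun (e : Σ k : Fin (p + 1), Fin (d k.castSucc) × Fin (d k.succ)) ω =>
        A e.1 ω e.2.1 e.2.2) P →
      ∫ ω, |meanAbs (chainVec (p + 1) d fun k => A k ω) - √(2 / Real.pi)| ∂P ≤ η := by
  -- With ε fixed, every error except 2ε = η/2 tends to 0 as N grows, so the limit lies strictly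
  -- below η.
  set ε := η / 4 with hε
  have hε0 : 0 < ε := by positivity
  set G := 3 * (M ^ 3 + ∫ x, |x| ^ 3 ∂(gaussianReal 0 1)) / ε ^ 2 with hG
  have hG0 : 0 ≤ G := by
    have : 0 ≤ ∫ x, |x| ^ 3 ∂(gaussianReal 0 1) := integral_nonneg fun x => by positivity
    positivity
  set R := (M ^ 2) ^ p with hR
  have hR0 : 0 ≤ R := by positivity
  have hlim : Filter.Tendsto (fun N : ℕ => √((1 + M ^ 2 * R) / N) + (2 * ε +
      G * ((√N)⁻¹ * (1 + R))) + √(2 / Real.pi) * √((4 * M ^ 2) ^ p / N)) Filter.atTop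
      (nhds (√0 + (2 * ε + G * (0 * (1 + R))) + √(2 / Real.pi) * √0)) := by
    have hs : Filter.Tendsto (fun N : ℕ => (√(N : ℝ))⁻¹) Filter.atTop (nhds 0) :=
      tendsto_inv_atTop_zero.comp (Real.tendsto_sqrt_atTop.comp tendsto_natCast_atTop_atTop)
    exact (((tendsto_const_div_atTop_nhds_zero_nat _).sqrt).add
      (((hs.mul_const _).const_mul _).const_add _)).add
      (((tendsto_const_div_atTop_nhds_zero_nat _).sqrt).const_mul _)
  have hlt : √0 + (2 * ε + G * (0 * (1 + R))) + √(2 / Real.pi) * √0 < η := by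
    simp only [Real.sqrt_zero, zero_mul, mul_zero, zero_add, add_zero]
    linarith
  obtain ⟨N, hN, hN1⟩ := ((hlim.eventually_lt_const hlt).and (Filter.eventually_ge_atTop 1)).exists
  refine ⟨N, hN1, fun d hd Ω _ P _ A hA hindep => le_trans ?_ hN.le⟩
  -- The first `p` layers supply the random input; the last one performs the averaging.
  obtain ⟨hb, h4, hs⟩ := chainVec_bounds hM hN1 p (fun i => d i.castSucc) (fun q => hd _)
    (fun k => A k.castSucc) (fun k => hA k.castSucc) (iIndepFun_prefix p d A hindep)
  have hUa := indepFun_chainVec_last p d A (fun k i j => (hA k).meas i j) hindep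
  have hd1 : N ≤ d (Fin.last p).succ := hd _
  have hd2 : N ≤ d (Fin.last p).castSucc := hd _
  have : Nonempty (Fin (d (Fin.last p).succ)) := ⟨⟨0, by omega⟩⟩
  have : Nonempty (Fin (d (Fin.last p).castSucc)) := ⟨⟨0, by omega⟩⟩
  refine ((hA (Fin.last p)).integral_abs_meanAbs_normStep_sub_le hb hUa hM h4 hR0 hs hM0
    hε0).trans ?_
  rw [Fintype.card_fin, Fintype.card_fin]
  have hN0 : (0 : ℝ) < N := by exact_mod_cast hN1
  have hdN1 : (N : ℝ) ≤ d (Fin.last p).succ := by exact_mod_cast hd1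
  have hdN2 : (N : ℝ) ≤ d (Fin.last p).castSucc := by exact_mod_cast hd2
  have e1 : √((1 + M ^ 2 * R) / d (Fin.last p).succ) ≤ √((1 + M ^ 2 * R) / N) := by gcongr
  have e2 : (√(d (Fin.last p).castSucc : ℝ))⁻¹ ≤ (√(N : ℝ))⁻¹ :=
    inv_anti₀ (Real.sqrt_pos.2 hN0) (Real.sqrt_le_sqrt hdN2)
  have e3 : G * ((√(d (Fin.last p).castSucc : ℝ))⁻¹ * (1 + R)) ≤ G * ((√(N : ℝ))⁻¹ * (1 + R)) := by
    gcongr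
  linarith

/-! ### Coupling of square integrable layers -/

section Coupling

variable {Ω ι κ : Type*} [MeasurableSpace Ω] [Fintype ι] {P : Measure Ω}
  {U U' : Ω → ι → ℝ} {a b : Ω → ι → κ → ℝ} {j : κ}

theorem memLp_two_mul_of_indepFun {X Y : Ω → ℝ} (h : IndepFun X Y P) (hX : MemLp X 2 P)
    (hY : MemLp Y 2 P) : MemLp (fun ω => X ω * Y ω) 2 P := by
  refine (memLp_two_iff_integrable_sq (f := fun ω => X ω * Y ω) (hX.1.mul hY.1)).2 ?_
  have := (h.comp (φ := fun x => x ^ 2) (ψ := fun x => x ^ 2) (by fun_prop)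
    (by fun_prop)).integrable_mul hX.integrable_sq hY.integrable_sq
  refine this.congr (ae_of_all _ fun ω => ?_)
  simp [mul_pow]

theorem memLp_normStep (h : ∀ i, IndepFun (fun ω => U ω i) (fun ω => a ω i j) P)
    (hU : ∀ i, MemLp (fun ω => U ω i) 2 P) (ha : ∀ i, MemLp (fun ω => a ω i j) 2 P) :
    MemLp (fun ω => normStep (U ω) (a ω) j) 2 P :=
  (memLp_finsetSum _ fun i _ => memLp_two_mul_of_indepFun (h i) (hU i) (ha i)).const_mul _

/-- In the expanded double sum, independence factors each term and the off-diagonal ones vanish,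
leaving the averaged input covariance times `ρ`. -/
theorem integral_normStep_mul [DecidableEq ι]
    (hU : ∀ i, MemLp (fun ω => U ω i) 2 P) (hU' : ∀ i, MemLp (fun ω => U' ω i) 2 P)
    (ha : ∀ i, MemLp (fun ω => a ω i j) 2 P) (hb : ∀ i, MemLp (fun ω => b ω i j) 2 P)
    (hUa : ∀ i, IndepFun (fun ω => U ω i) (fun ω => a ω i j) P)
    (hUb : ∀ i, IndepFun (fun ω => U' ω i) (fun ω => b ω i j) P)
    (h : ∀ i i', IndepFun (fun ω => U ω i * U' ω i') (fun ω => a ω i j * b ω i' j) P)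
    {ρ : ℝ} (hρ : ∀ i i', ∫ ω, a ω i j * b ω i' j ∂P = if i = i' then ρ else 0) :
    ∫ ω, normStep (U ω) (a ω) j * normStep (U' ω) (b ω) j ∂P
      = (Fintype.card ι : ℝ)⁻¹ * (∑ i, ∫ ω, U ω i * U' ω i ∂P) * ρ := by
  have hA (i) := memLp_two_mul_of_indepFun (hUa i) (hU i) (ha i)
  have hB (i) := memLp_two_mul_of_indepFun (hUb i) (hU' i) (hb i)
  have hc : (√(Fintype.card ι : ℝ))⁻¹ * (√(Fintype.card ι : ℝ))⁻¹ = (Fintype.card ι : ℝ)⁻¹ := by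
    rw [← mul_inv, Real.mul_self_sqrt (Nat.cast_nonneg _)]
  have e (ω) : normStep (U ω) (a ω) j * normStep (U' ω) (b ω) j = (Fintype.card ι : ℝ)⁻¹
      * ∑ i, ∑ i', (U ω i * a ω i j) * (U' ω i' * b ω i' j) := by
    simp only [normStep]
    rw [mul_mul_mul_comm, hc, Finset.sum_mul_sum]
  have hAB (i i') : Integrable (fun ω => (U ω i * a ω i j) * (U' ω i' * b ω i' j)) P :=
    (hA i).integrable_mul (hB i')
  simp_rw [e]
  rw [integral_const_mul, integral_finsetSum _ fun i _ => integrable_finsetSum _ fun i' _ =>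
    hAB i i', mul_assoc, Finset.sum_mul]
  congr 1
  refine Finset.sum_congr rfl fun i _ => ?_
  rw [integral_finsetSum _ fun i' _ => hAB i i']
  have e2 (i') : ∫ ω, (U ω i * a ω i j) * (U' ω i' * b ω i' j) ∂P
      = (∫ ω, U ω i * U' ω i' ∂P) * if i = i' then ρ else 0 := by
    rw [← hρ i i', ← (h i i').integral_fun_mul_eq_mul_integral
      ((hU i).1.mul (hU' i').1) ((ha i).1.mul (hb i').1)]
    simp_rw [mul_mul_mul_comm]
  simp [e2]

theorem integral_abs_meanAbs_sub_le [IsProbabilityMeasure P] [Nonempty ι] (hU : ∀ i, MemLp (fun ω => U ω i) 2 P)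
    (hU' : ∀ i, MemLp (fun ω => U' ω i) 2 P) {B : ℝ}
    (hB : ∀ i, ∫ ω, (U ω i - U' ω i) ^ 2 ∂P ≤ B) :
    ∫ ω, |meanAbs (U ω) - meanAbs (U' ω)| ∂P ≤ √B := by
  have hD (i) : MemLp (fun ω => U ω i - U' ω i) 2 P := (hU i).sub (hU' i)
  have hDi (i) : Integrable (fun ω => |U ω i - U' ω i|) P := ((hD i).integrable (by norm_num)).abs
  calc _ ≤ ∫ ω, (Fintype.card ι : ℝ)⁻¹ * ∑ i, |U ω i - U' ω i| ∂P := by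
        refine integral_mono_of_nonneg (ae_of_all _ fun ω => abs_nonneg _)
          ((integrable_finsetSum _ fun i _ => hDi i).const_mul _) (ae_of_all _ fun ω => ?_)
        simp only [meanAbs]
        rw [← mul_sub, ← Finset.sum_sub_distrib, abs_mul, abs_of_nonneg (by positivity)]
        gcongr
        exact (Finset.abs_sum_le_sum_abs _ _).trans
          (Finset.sum_le_sum fun i _ => abs_abs_sub_abs_le_abs_sub _ _)
    _ ≤ (Fintype.card ι : ℝ)⁻¹ * ∑ _i : ι, √B := by
        rw [integral_const_mul, integral_finsetSum _ fun i _ => hDi i]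
        gcongr with i
        exact integral_abs_le_sqrt_of_memLp (hD i) (hB i)
    _ = √B := by
        simp only [Finset.sum_const, Finset.card_univ, nsmul_eq_mul]
        field_simp

end Coupling

/-! ### Covariance of two chains driven by the same entries -/

section ChainCoupling

variable {Ω : Type*} [MeasurableSpace Ω] {P : Measure Ω} [IsProbabilityMeasure P]

/-- Starting from 1, the covariance is multiplied by `ρ k` at each layer, exactly and independently
of the sizes. Off-diagonal terms vanish by independence as soon as one of the two families, here
`σ`, is centred. -/
theorem integral_chainVec_mul (p : ℕ) (d : Fin (p + 1) → ℕ) (hd : ∀ q, d q ≠ 0)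
    (X : (k : Fin p) → Ω → Matrix (Fin (d k.castSucc)) (Fin (d k.succ)) ℝ)
    (hX : ∀ k i j, Measurable fun ω => X k ω i j)
    (hindep : iIndepFun (fun (e : Σ k : Fin p, Fin (d k.castSucc) × Fin (d k.succ)) ω =>
      X e.1 ω e.2.1 e.2.2) P) {σ τ : Fin p → ℝ → ℝ} (hσ : ∀ k, Measurable (σ k))
    (hτ : ∀ k, Measurable (τ k)) (hσ2 : ∀ k i j, MemLp (fun ω => σ k (X k ω i j)) 2 P)
    (hτ2 : ∀ k i j, MemLp (fun ω => τ k (X k ω i j)) 2 P)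
    (hσ0 : ∀ k i j, ∫ ω, σ k (X k ω i j) ∂P = 0) {ρ : Fin p → ℝ}
    (hρ : ∀ k i j, ∫ ω, σ k (X k ω i j) * τ k (X k ω i j) ∂P = ρ k) :
    (∀ j, MemLp (fun ω => chainVec p d (fun k => (X k ω).map (σ k)) j) 2 P) ∧
      (∀ j, MemLp (fun ω => chainVec p d (fun k => (X k ω).map (τ k)) j) 2 P) ∧
      ∀ j, ∫ ω, chainVec p d (fun k => (X k ω).map (σ k)) j
        * chainVec p d (fun k => (X k ω).map (τ k)) j ∂P = ∏ k, ρ k := by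
  induction p with
  | zero => exact ⟨fun j => memLp_const 1, fun j => memLp_const 1, fun j => by simp [chainVec]⟩
  | succ p ih =>
    obtain ⟨h1, h2, h3⟩ := ih (fun i => d i.castSucc) (fun q => hd _) (fun k => X k.castSucc)
      (fun k => hX k.castSucc) (iIndepFun_prefix p d X hindep) (σ := fun k => σ k.castSucc)
      (τ := fun k => τ k.castSucc) (fun k => hσ _) (fun k => hτ _) (fun k => hσ2 _)
      (fun k => hτ2 _) (fun k => hσ0 _) (ρ := fun k => ρ k.castSucc) (fun k => hρ _)
    have hpl := indepFun_prefix_last p d X hX hindep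
    have hm {φ : Fin (p + 1) → ℝ → ℝ} (hφ : ∀ k, Measurable (φ k)) :
        Measurable fun x : (Σ k : Fin p, Fin (d k.castSucc.castSucc) × Fin (d k.castSucc.succ)) → ℝ
          => chainVec p (fun i => d i.castSucc) fun k => (fun i j => φ k.castSucc (x ⟨k, i, j⟩) :
            Matrix (Fin (d k.castSucc.castSucc)) (Fin (d k.castSucc.succ)) ℝ) :=
      measurable_chainVec p (fun i => d i.castSucc) _ fun k i j => (hφ k.castSucc).comp
        (measurable_pi_apply (⟨k, i, j⟩ :
          Σ k : Fin p, Fin (d k.castSucc.castSucc) × Fin (d k.castSucc.succ)))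
    have hmi {φ : Fin (p + 1) → ℝ → ℝ} (hφ : ∀ k, Measurable (φ k)) i :=
      (measurable_pi_apply i).comp (hm hφ)
    have hl {φ : Fin (p + 1) → ℝ → ℝ} (hφ : ∀ k, Measurable (φ k)) i j :
        Measurable fun x : Fin (d (Fin.last p).castSucc) → Fin (d (Fin.last p).succ) → ℝ =>
          φ (Fin.last p) (x i j) := (hφ _).comp (by fun_prop)
    have hUa {φ : Fin (p + 1) → ℝ → ℝ} (hφ : ∀ k, Measurable (φ k)) i j :=
      hpl.comp (hmi hφ i) (hl hφ i j)
    refine ⟨fun j => memLp_normStep (a := fun ω i j => σ (Fin.last p) (X (Fin.last p) ω i j))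
        (fun i => hUa hσ i j) h1 (fun i => hσ2 _ i j),
      fun j => memLp_normStep (a := fun ω i j => τ (Fin.last p) (X (Fin.last p) ω i j))
        (fun i => hUa hτ i j) h2 (fun i => hτ2 _ i j), fun j => ?_⟩
    have := integral_normStep_mul (j := j)
      (a := fun ω i j => σ (Fin.last p) (X (Fin.last p) ω i j))
      (b := fun ω i j => τ (Fin.last p) (X (Fin.last p) ω i j)) h1 h2 (fun i => hσ2 (Fin.last p) i j)
      (fun i => hτ2 (Fin.last p) i j) (fun i => hUa hσ i j) (fun i => hUa hτ i j)
      (fun i i' => hpl.comp ((hmi hσ i).mul (hmi hτ i')) ((hl hσ i j).mul (hl hτ i' j)))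
      (ρ := ρ (Fin.last p)) fun i i' => by
        split_ifs with hii
        · subst hii
          exact hρ _ i j
        · have hne : (⟨Fin.last p, i, j⟩ : Σ k : Fin (p + 1), Fin (d k.castSucc) × Fin (d k.succ))
              ≠ ⟨Fin.last p, i', j⟩ := by simpa using hii
          have := ((hindep.indepFun hne).comp (hσ (Fin.last p))
            (hτ (Fin.last p))).integral_fun_mul_eq_mul_integral (hσ2 (Fin.last p) i j).1
            (hτ2 (Fin.last p) i' j).1
          refine this.trans ?_
          have h0 := hσ0 (Fin.last p) i j
          simp only [Function.comp_apply]
          rw [h0, zero_mul]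
    refine this.trans ?_
    have hd0 : (d (Fin.last p).castSucc : ℝ) ≠ 0 := by exact_mod_cast hd _
    rw [Finset.sum_congr rfl fun i _ => h3 i, Finset.sum_const, Finset.card_univ, Fintype.card_fin,
      nsmul_eq_mul, inv_mul_cancel_left₀ hd0, Fin.prod_univ_castSucc]

end ChainCoupling

/-! ### Bounded approximation of a law -/

/-- A bounded continuous function L²-close to the identity is centred, which cannot increase the
distance since the identity is itself centred, and then divided by its standard deviation s. -/
theorem exists_bounded_normalised_approx {μ : Measure ℝ} [IsProbabilityMeasure μ]
    (h2 : MemLp (fun x : ℝ => x) 2 μ) (hmean : ∫ x, x ∂μ = 0) (hvar : ∫ x, x ^ 2 ∂μ = 1) {η : ℝ}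
    (hη : 0 < η) :
    ∃ τ : ℝ → ℝ, IsBddMeasurable τ ∧ ∫ x, τ x ∂μ = 0 ∧ ∫ x, τ x ^ 2 ∂μ = 1 ∧
      1 - η ≤ ∫ x, x * τ x ∂μ := by
  -- The bound 1/2 forces s ≥ 1/2 below; together with δ ≤ η it gives δ² ≤ η/2.
  set δ := min (1 / 2) η with hδ
  have hδ0 : 0 < δ := lt_min (by norm_num) hη
  have hδ1 : δ ≤ 1 / 2 := min_le_left _ _
  obtain ⟨g, hg, -⟩ := h2.exists_boundedContinuous_eLpNorm_sub_le (by norm_num)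
    (ε := ENNReal.ofReal δ) (by simpa using hδ0)
  have hgb : IsBddMeasurable fun x => g x :=
    ⟨g.continuous.measurable, ‖g‖, fun x => g.norm_coe_le_norm x⟩
  have hxg : MemLp (fun x => x - g x) 2 μ := h2.sub (hgb.memLp 2)
  have hgδ : ∫ x, (x - g x) ^ 2 ∂μ ≤ δ ^ 2 := by
    have h := hxg.eLpNorm_eq_integral_rpow_norm (by norm_num) (by norm_num)
    have hg' : eLpNorm (fun x => x - g x) 2 μ ≤ ENNReal.ofReal δ := hg
    rw [h, ENNReal.ofReal_le_ofReal_iff hδ0.le] at hg'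
    simp only [ENNReal.toReal_ofNat, Real.norm_eq_abs, Real.rpow_two, sq_abs] at hg'
    have h0 : 0 ≤ ∫ x, (x - g x) ^ 2 ∂μ := integral_nonneg fun x => sq_nonneg _
    have := pow_le_pow_left₀ (Real.rpow_nonneg h0 _) hg' 2
    rwa [← Real.rpow_natCast, ← Real.rpow_mul h0, Nat.cast_ofNat,
      inv_mul_cancel₀ (by norm_num), Real.rpow_one] at this
  set m := ∫ x, g x ∂μ with hm
  set f : ℝ → ℝ := fun x => g x - m with hf
  have hfb : IsBddMeasurable f := hgb.sub (IsBddMeasurable.const m)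
  have hxi : Integrable (fun x : ℝ => x) μ := h2.integrable (by norm_num)
  have hf0 : ∫ x, f x ∂μ = 0 := by
    rw [integral_sub hgb.integrable (integrable_const _)]
    simp [hm]
  have hxf : MemLp (fun x => x - f x) 2 μ := h2.sub (hfb.memLp 2)
  have hfδ : ∫ x, (x - f x) ^ 2 ∂μ ≤ δ ^ 2 := by
    have e : ∀ x, (x - f x) ^ 2 = (x - g x) ^ 2 + 2 * m * (x - g x) + m ^ 2 := fun x => by
      simp only [hf]; ring
    simp_rw [e]
    have hi : Integrable (fun x => (x - g x) ^ 2 + 2 * m * (x - g x)) μ :=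
      hxg.integrable_sq.add ((hxg.integrable (by norm_num)).const_mul _)
    rw [integral_add hi (integrable_const _), integral_add hxg.integrable_sq
      ((hxg.integrable (by norm_num)).const_mul _), integral_const_mul,
      integral_sub hxi hgb.integrable, hmean, ← hm]
    simp
    nlinarith [sq_nonneg m]
  set v := ∫ x, f x ^ 2 ∂μ with hv
  have hxfi : Integrable (fun x => x * f x) μ := h2.integrable_mul (hfb.memLp 2)
  have hexp : ∫ x, (x - f x) ^ 2 ∂μ = 1 - 2 * (∫ x, x * f x ∂μ) + v := by
    have e : ∀ x, (x - f x) ^ 2 = x ^ 2 - 2 * (x * f x) + f x ^ 2 := fun x => by ring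
    simp_rw [e]
    have hi : Integrable (fun x => x ^ 2 - 2 * (x * f x)) μ :=
      h2.integrable_sq.sub (hxfi.const_mul 2)
    rw [integral_add hi (hfb.pow 2).integrable, integral_sub h2.integrable_sq (hxfi.const_mul 2),
      integral_const_mul, hvar]
  have hvlow : 1 / 4 ≤ v := by
    have : ∫ x, x ^ 2 ∂μ ≤ ∫ x, (2 * (x - f x) ^ 2 + 2 * f x ^ 2) ∂μ := by
      refine integral_mono h2.integrable_sq
        ((hxf.integrable_sq.const_mul 2).add ((hfb.pow 2).const_mul 2).integrable) fun x => ?_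
      change x ^ 2 ≤ 2 * (x - f x) ^ 2 + 2 * f x ^ 2
      nlinarith [sq_nonneg (x - 2 * f x)]
    rw [integral_add (hxf.integrable_sq.const_mul 2) ((hfb.pow 2).const_mul 2).integrable,
      integral_const_mul, integral_const_mul, hvar, ← hv] at this
    nlinarith
  set s := √v with hs
  have hss : s ^ 2 = v := Real.sq_sqrt (by linarith)
  have hslow : 1 / 2 ≤ s := Real.le_sqrt_of_sq_le (by linarith)
  have hs0 : 0 < s := by linarith
  refine ⟨fun x => s⁻¹ * f x, hfb.const_mul _, ?_, ?_, ?_⟩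
  · rw [integral_const_mul, hf0, mul_zero]
  · simp_rw [mul_pow]
    rw [integral_const_mul, ← hv, ← hss]
    field_simp
  · have e : ∀ x, x * (s⁻¹ * f x) = s⁻¹ * (x * f x) := fun x => by ring
    simp_rw [e]
    rw [integral_const_mul, inv_mul_eq_div, le_div_iff₀ hs0]
    have hδη : δ ≤ η := min_le_right _ _
    have hδ2 : δ ^ 2 ≤ η / 2 := by nlinarith
    -- Expanding the distance gives ∫ x f ≥ (1 + s² − δ²)/2 ≥ s − η/4, and s ≥ 1/2 makes this at
    -- least (1 − η)s.
    nlinarith [sq_nonneg (s - 1), mul_nonneg hη.le (sub_nonneg.2 hslow)]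

theorem isBddLayer_map {Ω : Type*} [MeasurableSpace Ω] {P : Measure Ω} {p : ℕ}
    {d : Fin (p + 1) → ℕ} {X : (k : Fin p) → Ω → Matrix (Fin (d k.castSucc)) (Fin (d k.succ)) ℝ}
    {μ : Fin p → Measure ℝ} (hX : ∀ k i j, Measurable fun ω => X k ω i j)
    (hlaw : ∀ k i j, HasLaw (fun ω => X k ω i j) (μ k) P)
    (hindep : iIndepFun (fun (e : Σ k : Fin p, Fin (d k.castSucc) × Fin (d k.succ)) ω =>
      X e.1 ω e.2.1 e.2.2) P) {τ : Fin p → ℝ → ℝ} (hτ : ∀ k, Measurable (τ k)) {M : ℝ}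
    (hM : ∀ k x, |τ k x| ≤ M) (hτ0 : ∀ k, ∫ x, τ k x ∂(μ k) = 0)
    (hτ1 : ∀ k, ∫ x, τ k x ^ 2 ∂(μ k) = 1) (k : Fin p) :
    IsBddLayer P (fun ω i j => (X k ω).map (τ k) i j) M where
  indep := (hindep.precomp (g := fun e : Fin (d k.castSucc) × Fin (d k.succ) =>
    (⟨k, e⟩ : Σ k : Fin p, Fin (d k.castSucc) × Fin (d k.succ)))
    fun _ _ h => by simpa using h).comp (fun _ => τ k) fun _ => hτ k
  meas i j := (hτ k).comp (hX k i j)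
  bdd i j ω := hM k _
  mean i j := ((hlaw k i j).integral_comp (hτ k).aestronglyMeasurable).trans (hτ0 k)
  var i j := ((hlaw k i j).integral_comp (f := fun x => τ k x ^ 2)
    ((hτ k).pow_const 2).aestronglyMeasurable).trans (hτ1 k)

/-- Half of η pays for the coupling with a bounded chain, the other half for the convergence of that
chain. -/
theorem exists_integral_abs_meanAbs_chainVec_sub_le_of_hasLaw.{u} (p : ℕ) (hp : 1 ≤ p)
    (μ : Fin p → Measure ℝ) [∀ k, IsProbabilityMeasure (μ k)]
    (h2 : ∀ k, MemLp (fun x : ℝ => x) 2 (μ k)) (hmean : ∀ k, ∫ x, x ∂(μ k) = 0)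
    (hvar : ∀ k, ∫ x, x ^ 2 ∂(μ k) = 1) {η : ℝ} (hη : 0 < η) :
    ∃ N : ℕ, ∀ d : Fin (p + 1) → ℕ, (∀ q, N ≤ d q) → ∀ {Ω : Type u} [MeasurableSpace Ω]
      (P : Measure Ω) [IsProbabilityMeasure P]
      (X : (k : Fin p) → Ω → Matrix (Fin (d k.castSucc)) (Fin (d k.succ)) ℝ),
      (∀ k i j, Measurable fun ω => X k ω i j) →
      (∀ k i j, HasLaw (fun ω => X k ω i j) (μ k) P) →
      iIndepFun (fun (e : Σ k : Fin p, Fin (d k.castSucc) × Fin (d k.succ)) ω =>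
        X e.1 ω e.2.1 e.2.2) P →
      Integrable (fun ω => meanAbs (chainVec p d fun k => X k ω) - √(2 / Real.pi)) P ∧
        ∫ ω, |meanAbs (chainVec p d fun k => X k ω) - √(2 / Real.pi)| ∂P ≤ η := by
  have hp0 : (0 : ℝ) < p := by exact_mod_cast hp
  -- By Bernoulli, (1 − θ)^p ≥ 1 − pθ ≥ 1 − (η/2)²/2, so 2 − 2∏ρ ≤ (η/2)². The cap 1 keeps 1 − θ
  -- nonnegative.
  set θ : ℝ := min 1 ((η / 2) ^ 2 / (2 * p)) with hθ
  have hθ0 : 0 < θ := lt_min one_pos (by positivity)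
  choose τ hτb hτ0 hτ1 hτρ using fun k =>
    exists_bounded_normalised_approx (h2 k) (hmean k) (hvar k) hθ0
  choose M' hM' using fun k => (hτb k).2
  have hM'0 (k) : 0 ≤ M' k := (abs_nonneg _).trans (hM' k 0)
  -- A common bound for all the τ's; the summand 2 guarantees 3 ≤ M².
  set M : ℝ := 2 + ∑ k, M' k with hM
  have hM2 : 2 ≤ M := le_add_of_nonneg_right (Finset.sum_nonneg fun k _ => hM'0 k)
  have hτM (k x) : |τ k x| ≤ M := by
    have := Finset.single_le_sum (f := M') (fun k _ => hM'0 k) (Finset.mem_univ k)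
    exact (hM' k x).trans (by linarith)
  obtain ⟨q, rfl⟩ : ∃ q, p = q + 1 := ⟨p - 1, by omega⟩
  obtain ⟨N, hN1, hN⟩ := exists_integral_abs_meanAbs_chainVec_sub_le.{u} q (M := M) (by linarith)
    (by nlinarith) (half_pos hη)
  refine ⟨N, fun d hd Ω _ P _ X hX hlaw hindep => ?_⟩
  have hd0 (q) : d q ≠ 0 := by have := hd q; omega
  have hcomp (k i j) {f : ℝ → ℝ} (hf : Measurable f) :
      ∫ ω, f (X k ω i j) ∂P = ∫ x, f x ∂(μ k) :=
    (hlaw k i j).integral_comp hf.aestronglyMeasurable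
  have hX2 (k i j) : MemLp (fun ω => X k ω i j) 2 P := by
    have := h2 k
    rw [← (hlaw k i j).map_eq, memLp_map_measure_iff (by fun_prop) (hX k i j).aemeasurable] at this
    exact this
  have hτ2 (k i j) : MemLp (fun ω => τ k (X k ω i j)) 2 P := ((hτb k).comp (hX k i j)).memLp 2
  have hlay := isBddLayer_map hX hlaw hindep (fun k => (hτb k).1) hτM hτ0 hτ1
  -- The pairs (id, τ), (id, id) and (τ, τ) give the three terms of the expanded squared difference.
  obtain ⟨hV, hV', hVV'⟩ := integral_chainVec_mul (q + 1) d hd0 X hX hindep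
    (σ := fun _ x => x) (τ := τ) (fun _ => measurable_id) (fun k => (hτb k).1) hX2 hτ2
    (fun k i j => (hcomp k i j measurable_id).trans (hmean k))
    (fun k i j => hcomp k i j (f := fun x => x * τ k x) (measurable_id.mul (hτb k).1))
  obtain ⟨-, -, hVV⟩ := integral_chainVec_mul (q + 1) d hd0 X hX hindep
    (σ := fun _ x => x) (τ := fun _ x => x) (fun _ => measurable_id) (fun _ => measurable_id)
    hX2 hX2 (fun k i j => (hcomp k i j measurable_id).trans (hmean k)) (ρ := fun _ => 1)
    (fun k i j => (hcomp k i j (f := fun x => x * x) (by fun_prop)).trans (by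
      simpa only [pow_two] using hvar k))
  obtain ⟨-, -, hVV2⟩ := integral_chainVec_mul (q + 1) d hd0 X hX hindep
    (σ := τ) (τ := τ) (fun k => (hτb k).1) (fun k => (hτb k).1)
    hτ2 hτ2 (fun k i j => (hcomp k i j (hτb k).1).trans (hτ0 k)) (ρ := fun _ => 1)
    (fun k i j => (hcomp k i j (f := fun x => τ k x * τ k x) ((hτb k).1.mul (hτb k).1)).trans (by
      simpa only [pow_two] using hτ1 k))
  change ∀ j, MemLp (fun ω => chainVec (q + 1) d (fun k => X k ω) j) 2 P at hV
  change ∀ j, ∫ ω, chainVec (q + 1) d (fun k => X k ω) j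
    * chainVec (q + 1) d (fun k => (X k ω).map (τ k)) j ∂P = _ at hVV'
  change ∀ j, ∫ ω, chainVec (q + 1) d (fun k => X k ω) j
    * chainVec (q + 1) d (fun k => X k ω) j ∂P = _ at hVV
  have : Nonempty (Fin (d (Fin.last (q + 1)))) := ⟨⟨0, Nat.pos_of_ne_zero (hd0 _)⟩⟩
  have hprod : 1 - (η / 2) ^ 2 / 2 ≤ ∏ k, ∫ x, x * τ k x ∂(μ k) := by
    have h1 : (1 - θ) ^ (q + 1) ≤ ∏ k, ∫ x, x * τ k x ∂(μ k) := by
      have := Finset.prod_le_prod (s := (Finset.univ : Finset (Fin (q + 1))))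
        (f := fun _ => 1 - θ) (fun _ _ => sub_nonneg.2 (min_le_left _ _)) (fun k _ => hτρ k)
      simpa using this
    have h3 : θ ≤ (η / 2) ^ 2 / (2 * (q + 1 : ℕ)) := min_le_right _ _
    rw [le_div_iff₀ (by positivity)] at h3
    have h4 := one_add_mul_le_pow (a := -θ) (by linarith [min_le_left 1 ((η / 2) ^ 2 /
      (2 * ((q + 1 : ℕ) : ℝ)))]) (q + 1)
    rw [← sub_eq_add_neg 1 θ] at h4
    linarith
  have hdiff (j) : ∫ ω, (chainVec (q + 1) d (fun k => X k ω) j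
      - chainVec (q + 1) d (fun k => (X k ω).map (τ k)) j) ^ 2 ∂P ≤ (η / 2) ^ 2 := by
    have i1 := (hV j).integrable_mul (hV j)
    have i2 := (hV j).integrable_mul (hV' j)
    have i3 := (hV' j).integrable_mul (hV' j)
    have e (x y : ℝ) : (x - y) ^ 2 = x * x - 2 * (x * y) + y * y := by ring
    simp_rw [e]
    have i12 := i1.sub (i2.const_mul 2)
    refine (integral_add i12 i3).le.trans ?_
    have := integral_sub i1 (i2.const_mul 2)
    refine (add_le_add_left this.le _).trans ?_
    rw [integral_const_mul]
    simp only [Pi.mul_apply]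
    rw [hVV, hVV', hVV2]
    simp only [Finset.prod_const_one]
    linarith
  have hmA {V : Ω → Fin (d (Fin.last (q + 1))) → ℝ} (h : ∀ j, MemLp (fun ω => V ω j) 2 P) :
      Integrable (fun ω => meanAbs (V ω)) P :=
    (integrable_finsetSum _ fun j _ => ((h j).integrable (by norm_num)).abs).const_mul _
  have hI := hmA hV
  have hI' := hmA hV'
  refine ⟨hI.sub (integrable_const _), ?_⟩
  have b1 := integral_abs_meanAbs_sub_le hV hV' hdiff
  rw [Real.sqrt_sq (half_pos hη).le] at b1
  have hind : iIndepFun (fun (e : Σ k : Fin (q + 1), Fin (d k.castSucc) × Fin (d k.succ)) ω =>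
      (X e.1 ω).map (τ e.1) e.2.1 e.2.2) P :=
    hindep.comp (fun e => τ e.1) fun e => (hτb e.1).1
  have b2 := hN d hd P (fun k ω => (X k ω).map (τ k)) hlay hind
  refine (integral_mono (hI.sub (integrable_const _)).abs
    ((hI.sub hI').abs.add (hI'.sub (integrable_const (√(2 / Real.pi)))).abs)
    fun ω => abs_sub_le _ _ _).trans ?_
  refine (integral_add (hI.sub hI').abs
    (hI'.sub (integrable_const (√(2 / Real.pi)))).abs).le.trans ?_
  exact (add_le_add b1 b2).trans (by linarith)

/-- `A n k` is the random matrix of size `n k × n (k + 1)`, indexed from `k = 0`; its entries have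
the law `μ k`, which does not depend on the sizes `n`. All entries of all the matrices are jointly
independent. The number of rows `m` of the all-ones matrix is arbitrary. -/
theorem theorem1p4 (p : ℕ) (hp : 1 ≤ p) (α : ℝ) (hα : 1 < α)
    (μ : Fin p → Measure ℝ) [∀ k, IsProbabilityMeasure (μ k)]
    (hmoment : ∀ k, MemLp (fun x : ℝ => x) (ENNReal.ofReal (2 * α)) (μ k))
    (hcentered : ∀ k, ∫ x, x ∂(μ k) = 0)
    (hvar : ∀ k, variance (fun x : ℝ => x) (μ k) = 1)
    {Ω : (Fin (p + 1) → ℕ) → Type*} [∀ n, MeasurableSpace (Ω n)]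
    (Pr : ∀ n, Measure (Ω n)) [∀ n, IsProbabilityMeasure (Pr n)]
    (A : ∀ (n : Fin (p + 1) → ℕ) (k : Fin p),
      Ω n → Matrix (Fin (n k.castSucc)) (Fin (n k.succ)) ℝ)
    (hlaw : ∀ n k i j, HasLaw (fun ω => A n k ω i j) (μ k) (Pr n))
    (hindep : ∀ n, iIndepFun
      (fun (e : Σ k : Fin p, Fin (n k.castSucc) × Fin (n k.succ)) (ω : Ω n) =>
        A n e.1 ω e.2.1 e.2.2) (Pr n))
    (m : (Fin (p + 1) → ℕ) → ℕ) (hm : ∀ n, 1 ≤ m n) :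
    TendstoInProbComparable Pr
      (fun n ω =>
        (n (Fin.last p) : ℝ)⁻¹ * (∏ k : Fin p, (n k.castSucc : ℝ)) ^ (-(1 / 2) : ℝ) *
          linftyOperatorNorm
            (onesMatrix (m n) (n 0) * chainProd p n (fun k => A n k ω)))
      (Real.sqrt (2 / Real.pi)) := by
  intro C ε δ hε hδ
  have h2 (k) : MemLp (fun x : ℝ => x) 2 (μ k) := (hmoment k).mono_exponent (by
    rw [← ENNReal.ofReal_ofNat 2]
    exact ENNReal.ofReal_le_ofReal (by linarith))
  have hsq (k) : ∫ x, x ^ 2 ∂(μ k) = 1 := by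
    have := hvar k
    rw [variance_eq_integral measurable_id'.aemeasurable, hcentered] at this
    simpa using this
  -- A mean error of εδ is what Markov's inequality at level ε turns into probability δ.
  obtain ⟨N, hN⟩ := exists_integral_abs_meanAbs_chainVec_sub_le_of_hasLaw p hp μ h2 hcentered hsq
    (mul_pos hε hδ)
  refine ⟨N, fun n hn => ?_⟩
  have hae (k i j) := (hlaw n k i j).aemeasurable
  -- The entries are only a.e. measurable; measurable versions have the same laws, joint
  -- independence and probabilities.
  set X : (k : Fin p) → Ω n → Matrix (Fin (n k.castSucc)) (Fin (n k.succ)) ℝ :=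
    fun k ω i j => (hae k i j).mk _ ω with hX
  have hAX (k i j) : (fun ω => A n k ω i j) =ᵐ[Pr n] fun ω => X k ω i j := (hae k i j).ae_eq_mk
  have hall : ∀ᵐ ω ∂(Pr n), ∀ k i j, A n k ω i j = X k ω i j := by
    simp only [ae_all_iff]
    exact hAX
  obtain ⟨hint, hle⟩ := hN n (fun q => (hn q q).1) (Pr n) X (fun k i j => (hae k i j).measurable_mk)
    (fun k i j => (hlaw n k i j).congr (hAX k i j).symm)
    ((hindep n).congr fun e => hAX e.1 e.2.1 e.2.2)
  have hmk := mul_meas_ge_le_integral_of_nonneg (ae_of_all _ fun ω => abs_nonneg _) hint.abs ε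
  have hfin : (Pr n).real {ω | ε ≤ |meanAbs (chainVec p n fun k => X k ω) - √(2 / Real.pi)|} ≤ δ :=
    le_of_mul_le_mul_left (hmk.trans hle) hε
  have hset : (Pr n) {ω | ε ≤ |(n (Fin.last p) : ℝ)⁻¹ *
      (∏ k : Fin p, (n k.castSucc : ℝ)) ^ (-(1 / 2) : ℝ) * linftyOperatorNorm
        (onesMatrix (m n) (n 0) * chainProd p n (fun k => A n k ω)) - √(2 / Real.pi)|}
      = (Pr n) {ω | ε ≤ |meanAbs (chainVec p n fun k => X k ω) - √(2 / Real.pi)|} := by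
    refine measure_congr ?_
    filter_upwards [hall] with ω hω
    have : (fun k => A n k ω) = fun k => X k ω := by
      funext k
      ext i j
      exact hω k i j
    simp only [eq_iff_iff]
    change _ ≤ _ ↔ _ ≤ _
    rw [scaled_norm_eq_meanAbs_chainVec (hm n), this]
  rw [hset]
  exact (ENNReal.le_ofReal_iff_toReal_le (measure_ne_top _ _) hδ.le).2 hfin
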